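/- Let $\mu_1,\mu_2>0$, $\epsilon_1,\epsilon_2\in\{1,-1\}$, let $c,\lambda_1,\lambda_2\in\mathbb R$ with $|\lambda_2|>|c|$, let $z_1,z_2\in\mathbb C$ with $z_2\neq0$ and $z_1^2+z_2^2\neq 0$, and let $w=(z_1^2+z_2^2)^{1/2}$ be either square root; accordingly $\left(\frac{z_1^2}{z_2^2}+1\right)^{-1/2}$ denotes $z_2/w$ (for real $z_1$ and $z_2>0$ all roots may be taken positive). Write $(a)_n=a(a+1)\cdots(a+n-1)$, $[n]_\mu=n+(1-(-1)^n)\mu$, $[n]_\mu!=[1]_\mu[2]_\mu\cdots[n]_\mu$, and for $j\in\mathbb N$ put $\mu_{12}=\mu_1+\mu_2+\tfrac12+j$ and $\epsilon_{12}=\epsilon_1\epsilon_2(-1)^j$. The Big $-1$ Jacobi polynomials are $$J_n(x;a,b,c)=\begin{cases}{}_2F_1\!\left(-\tfrac n2,\tfrac{n+a+b+2}2;\tfrac{a+1}2;\tfrac{1-x^2}{1-c^2}\right)+\frac{n(1-x)}{(1+c)(a+1)}\,{}_2F_1\!\left(1-\tfrac n2,\tfrac{n+a+b+2}2;\tfrac{a+3}2;\tfrac{1-x^2}{1-c^2}\right),&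 n\text{ even},\\[2mm]{}_2F_1\!\left(-\tfrac{n-1}2,\tfrac{n+a+b+1}2;\tfrac{a+1}2;\tfrac{1-x^2}{1-c^2}\right)-\frac{(n+a+b+1)(1-x)}{(1+c)(a+1)}\,{}_2F_1\!\left(-\tfrac{n-1}2,\tfrac{n+a+b+3}2;\tfrac{a+3}2;\tfrac{1-x^2}{1-c^2}\right),& n\text{ odd}\end{cases}$$ (the second term being $0$ for $n=0$), and $$h_n(a,b)=\begin{cases}\dfrac{2\,\Gamma(\frac{n+b+1}2)\Gamma(\frac{n+a+3}2)(\frac n2)!}{(n+a+1)\Gamma(\frac{n+a+b+2}2)\left(\frac{a+1}2\right)_{n/2}^2},& n\text{ even},\\[4mm]\dfrac{(n+a+b+1)\Gamma(\frac{n+b+2}2)\Gamma(\frac{n+a+2}2)(\frac{n-1}2)!}{2\,\Gamma(\frac{n+a+b+3}2)\left(\frac{a+1}2\right)_{(n+1)/2}^2},& n\text{ odd}.\end{cases}$$ Let $$K_j(\lambda_2;\mu_2,\mu_1;c)=\operatorname{sign}(\lambda_2)^j\sqrt{\left(\tfrac{\lambda_2^2-c^2}2\right)^j\left(\tfrac{\lambda_2-c\epsilon_1\epsilon_2}{\lambda_2-(-1)^jc\epsilon_1\epsilon_2}\right)\frac{\Gamma(\mu_1+\frac12)\Gamma(\mu_2+\frac12)}{\Gamma(\mu_{12}+\frac12)\,h_j(2\mu_2,2\mu_1)}}\,.$$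 Writing $j=2j_e+j_p$ with $j_p\in\{0,1\}$, let $$N_j=\frac{(-1)^{j_e+j_p}}{\sqrt{[j]_{\mu_2}!}}\left[\frac{(\frac12+\mu_1)_{j_e+j_p}}{(j_e+1+\mu_1+\mu_2)_{j_e+j_p}}\right]^{1/2},\qquad t=-\left(\frac{z_1}{z_2}\right)^2,$$ $$f_e(j)=N_j z_2^j\left({}_2F_1\!\left(-j_e,\tfrac12-j_e-j_p-\mu_2;\tfrac12+\mu_1;t\right)+\frac{(-1)^{j_p}z_1(j+2\mu_2j_p)}{z_2\epsilon_2(1+2\mu_1)}\,{}_2F_1\!\left(1-j_e-j_p,\tfrac12-j_e-\mu_2;\tfrac32+\mu_1;t\right)\right)$$ (the second term being $0$ for $j=0$) and $$f_o(j)=\left(\tfrac{z_1^2}{z_2^2}+1\right)^{-1/2}N_j z_2^j\left({}_2F_1\!\left(-j_e-j_p,-\tfrac12-j_e-\mu_2;\tfrac12+\mu_1;t\right)+\frac{(-1)^{j_p}z_1(j+1+2\mu_1+2\mu_2j_p)}{z_2\epsilon_2(1+2\mu_1)}\,{}_2F_1\!\left(-j_e,\tfrac12-j_e-j_p-\mu_2;\tfrac32+\mu_1;t\right)\right).$$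 Then $$\begin{aligned}&\left({}_0F_1\!\left(-;\mu_1+\tfrac12;\tfrac{z_1^2(\lambda_1^2-c^2)}4\right)+\frac{z_1(\lambda_1-c\epsilon_1)}{2\mu_1+1}\,{}_0F_1\!\left(-;\mu_1+\tfrac32;\tfrac{z_1^2(\lambda_1^2-c^2)}4\right)\right)\\&\times\left({}_0F_1\!\left(-;\mu_2+\tfrac12;\tfrac{z_2^2(\lambda_2^2-\lambda_1^2)}4\right)+\frac{z_2(\lambda_2-\lambda_1\epsilon_2)}{2\mu_2+1}\,{}_0F_1\!\left(-;\mu_2+\tfrac32;\tfrac{z_2^2(\lambda_2^2-\lambda_1^2)}4\right)\right)\\&=\sum_{j=0}^\infty K_j(\lambda_2;\mu_2,\mu_1;c)\,J_j\!\left(\tfrac{\epsilon_2\lambda_1}{\lambda_2};2\mu_2,2\mu_1,-\tfrac{c\epsilon_1\epsilon_2}{\lambda_2}\right)\\&\quad\times\left(f_e(j)\,{}_0F_1\!\left(-;\mu_{12}+\tfrac12;\tfrac{(z_1^2+z_2^2)(\lambda_2^2-c^2)}4\right)+f_o(j)\frac{(z_1^2+z_2^2)^{1/2}(\lambda_2-c\epsilon_{12})}{2\mu_{12}+1}\,{}_0F_1\!\left(-;\mu_{12}+\tfrac32;\tfrac{(z_1^2+z_2^2)(\lambda_2^2-c^2)}4\right)\right),\end{aligned}$$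 where the series on the right converges absolutely. -/

import Mathlib

noncomputable section

namespace DunklOP

/-- The Pochhammer symbol `(a)_n = a (a + 1) ⋯ (a + n - 1)`. -/
def poch (a : ℝ) (n : ℕ) : ℝ := ∏ k ∈ Finset.range n, (a + k)

/-- The hypergeometric function `₀F₁(-; b; x) = ∑ xⁿ / ((b)_n n!)`, an everywhere convergent
series when `b > 0`. -/
def hyp01 (b : ℝ) (x : ℂ) : ℂ :=
  ∑' n : ℕ, x ^ n / ((poch b n : ℂ) * (n.factorial : ℂ))

/-- The `μ`-number `[n]_μ = n + (1 - (-1)ⁿ) μ`. -/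
def muNum (n : ℕ) (μ : ℝ) : ℝ := n + (1 - (-1) ^ n) * μ

/-- The `μ`-factorial `[n]_μ! = [1]_μ [2]_μ ⋯ [n]_μ`. -/
def muFact (n : ℕ) (μ : ℝ) : ℝ := ∏ k ∈ Finset.range n, muNum (k + 1) μ

/-- The Big -1 Jacobi polynomials `J_n(x; a, b, c)`. -/
def bigJacobi (n : ℕ) (x a b c : ℝ) : ℝ :=
  if Even n then
    ordinaryHypergeometric (-(n : ℝ) / 2) ((n + a + b + 2) / 2) ((a + 1) / 2)
        ((1 - x ^ 2) / (1 - c ^ 2))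
      + n * (1 - x) / ((1 + c) * (a + 1)) *
        ordinaryHypergeometric (1 - (n : ℝ) / 2) ((n + a + b + 2) / 2) ((a + 3) / 2)
          ((1 - x ^ 2) / (1 - c ^ 2))
  else
    ordinaryHypergeometric (-((n : ℝ) - 1) / 2) ((n + a + b + 1) / 2) ((a + 1) / 2)
        ((1 - x ^ 2) / (1 - c ^ 2))
      - (n + a + b + 1) * (1 - x) / ((1 + c) * (a + 1)) *
        ordinaryHypergeometric (-((n : ℝ) - 1) / 2) ((n + a + b + 3) / 2) ((a + 3) / 2)
          ((1 - x ^ 2) / (1 - c ^ 2))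

/-- The factor `h_n(a, b)` in the squared norm of the Big -1 Jacobi polynomials. -/
def jacobiNorm (n : ℕ) (a b : ℝ) : ℝ :=
  if Even n then
    2 * Real.Gamma ((n + b + 1) / 2) * Real.Gamma ((n + a + 3) / 2) * ((n / 2).factorial : ℝ) /
      ((n + a + 1) * Real.Gamma ((n + a + b + 2) / 2) * poch ((a + 1) / 2) (n / 2) ^ 2)
  else
    (n + a + b + 1) * Real.Gamma ((n + b + 2) / 2) * Real.Gamma ((n + a + 2) / 2) *
        (((n - 1) / 2).factorial : ℝ) /
      (2 * Real.Gamma ((n + a + b + 3) / 2) * poch ((a + 1) / 2) ((n + 1) / 2) ^ 2)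

/-- `μ₁₂ = μ₁ + μ₂ + 1/2 + j`. -/
def mu12 (μ₁ μ₂ : ℝ) (j : ℕ) : ℝ := μ₁ + μ₂ + 1 / 2 + j

/-- `ε₁₂ = ε₁ ε₂ (-1)ʲ`. -/
def eps12 (ε₁ ε₂ : ℝ) (j : ℕ) : ℝ := ε₁ * ε₂ * (-1) ^ j

/-- The normalization factor `K_j(lam₂; μ₂, μ₁; c)`. The square root is taken with the sign of
`lam₂ ^ j`; it is the usual nonnegative square root when `lam₂ > 0` or `j` is even. -/
def normK (j : ℕ) (lam₂ μ₂ μ₁ c ε₁ ε₂ : ℝ) : ℝ :=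
  Real.sign lam₂ ^ j *
    √(((lam₂ ^ 2 - c ^ 2) / 2) ^ j *
      ((lam₂ - c * ε₁ * ε₂) / (lam₂ - (-1) ^ j * c * ε₁ * ε₂)) *
      (Real.Gamma (μ₁ + 1 / 2) * Real.Gamma (μ₂ + 1 / 2) /
        (Real.Gamma (mu12 μ₁ μ₂ j + 1 / 2) * jacobiNorm j (2 * μ₂) (2 * μ₁))))

/-- The constant `(-1)^(j_e + j_p) ([j]_{μ₂}!)^(-1/2)
[(1/2 + μ₁)_{j_e + j_p} / (j_e + 1 + μ₁ + μ₂)_{j_e + j_p}]^(1/2)`,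
where `j = 2 j_e + j_p` with `j_p ∈ {0, 1}`. -/
def prefactor (j : ℕ) (μ₁ μ₂ : ℝ) : ℝ :=
  (-1) ^ (j / 2 + j % 2) / √(muFact j μ₂) *
    √(poch (1 / 2 + μ₁) (j / 2 + j % 2) /
      poch (((j / 2 : ℕ) : ℝ) + 1 + μ₁ + μ₂) (j / 2 + j % 2))

/-- The coefficient `f_e(j)`; here `je = j_e` and `jp = j_p`. -/
def fe (j : ℕ) (μ₁ μ₂ ε₂ : ℝ) (z₁ z₂ : ℂ) : ℂ :=
  let je : ℝ := ((j / 2 : ℕ) : ℝ)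
  let jp : ℝ := ((j % 2 : ℕ) : ℝ)
  (prefactor j μ₁ μ₂ : ℂ) * z₂ ^ j *
    (ordinaryHypergeometric (-je) (1 / 2 - je - jp - μ₂) (1 / 2 + μ₁) (-(z₁ / z₂) ^ 2)
      + (-1) ^ (j % 2) * z₁ * ((j + 2 * μ₂ * jp : ℝ) : ℂ) / (z₂ * ((ε₂ * (1 + 2 * μ₁) : ℝ) : ℂ)) *
        ordinaryHypergeometric (1 - je - jp) (1 / 2 - je - μ₂) (3 / 2 + μ₁) (-(z₁ / z₂) ^ 2))

/-- The coefficient `f_o(j)`. The parameter `w` is a square root of `z₁² + z₂²`, and the factor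
`(z₁² / z₂² + 1)^(-1/2)` is `z₂ / w`. -/
def fo (j : ℕ) (μ₁ μ₂ ε₂ : ℝ) (z₁ z₂ w : ℂ) : ℂ :=
  let je : ℝ := ((j / 2 : ℕ) : ℝ)
  let jp : ℝ := ((j % 2 : ℕ) : ℝ)
  (z₂ / w) * (prefactor j μ₁ μ₂ : ℂ) * z₂ ^ j *
    (ordinaryHypergeometric (-je - jp) (-1 / 2 - je - μ₂) (1 / 2 + μ₁) (-(z₁ / z₂) ^ 2)
      + (-1) ^ (j % 2) * z₁ * ((j + 1 + 2 * μ₁ + 2 * μ₂ * jp : ℝ) : ℂ) /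
          (z₂ * ((ε₂ * (1 + 2 * μ₁) : ℝ) : ℂ)) *
        ordinaryHypergeometric (-je) (1 / 2 - je - jp - μ₂) (3 / 2 + μ₁) (-(z₁ / z₂) ^ 2))

end DunklOP

end

/-!
The expansion is four copies of one classical product formula, interlaced. Write `a = μ₁ + 1/2`,
`b = μ₂ + 1/2`, `s = (λ₂² - c²) / 4`, `q = (λ₂² - λ₁²) / 4`, `x = z₁²`, `y = z₂²`. The left side is a
sum of four products of functions `₀F₁`, one for each pair of parities in `(z₁, z₂)`, and each of
them is expanded by

`₀F₁(a; x (s - q)) ₀F₁(b; y q)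
  = ∑ₘ (-s)ᵐ / (m! (m + a + b - 1)ₘ) ₂F₁(-m, m + a + b - 1; b; q / s)
      Qₘ(x, y) ₀F₁(a + b + 2 m; (x + y) s)`,

where `Qₘ(x, y) = yᵐ ₂F₁(-m, 1 - m - b; a; -x / y)` (`hasSum_product_formula`, applied with
parameters `(a, b)`, `(a + 1, b + 1)`, `(a, b + 1)` and `(a + 1, b)`).

The product formula is proved on coefficients of formal power series in `x`, `y`. For `s = 1` both
sides are fixed by the operator `x ∂x² + a ∂x + y ∂y² + b ∂y`: it kills each `Qₘ`, and it lowers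
powers of `x + y` times `Qₘ` by an `sl₂` relation (`besselOp_mulAdd_iterate_harm`). A formal series
fixed by the operator is determined by its restriction to `x = 0` (`eq_of_besselOp_fixed`), and
there the formula is the expansion of a monomial in Jacobi polynomials, which is an inverse pair
with a telescoping sum (`inversePair`). Convergence follows from explicit factorial bounds.

On the other side, the normalization constants multiply to rational expressions (the square roots
disappear), and the coefficients `fe`, `fo` are combinations of the polynomials `Qₘ`. Apart from
the constant one with parameters `(a, b)`, each of these polynomials occurs in one term of even
index and one of odd index, and contiguous relations of
`₂F₁` collapse the resulting combination of two Big `-1` Jacobi polynomials to the single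
polynomial of the product formula (`evenCoeff_succ_sub_oddCoeff` and its three companions). The
sums over even and odd indices are then put together in `hasSum_of_even_odd`.
-/

namespace DunklOP
open Finset

/-! ### Pochhammer symbols -/

@[simp] lemma poch_zero (a : ℝ) : poch a 0 = 1 := by simp [poch]

lemma poch_succ (a : ℝ) (n : ℕ) : poch a (n + 1) = poch a n * (a + n) := by
  simp [poch, prod_range_succ]

lemma poch_succ_left (a : ℝ) (n : ℕ) : poch a (n + 1) = a * poch (a + 1) n := by
  simp only [poch, prod_range_succ']
  rw [mul_comm]
  congr 1
  · simp
  · exact prod_congr rfl fun k _ => by push_cast; ring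

lemma poch_pos {a : ℝ} (ha : 0 < a) (n : ℕ) : 0 < poch a n :=
  prod_pos fun _ _ => by positivity

lemma poch_ne_zero {a : ℝ} (ha : 0 < a) (n : ℕ) : poch a n ≠ 0 := (poch_pos ha n).ne'

lemma poch_add (a : ℝ) (m n : ℕ) : poch a (m + n) = poch a m * poch (a + m) n := by
  simp only [poch, prod_range_add]
  congr 1
  exact prod_congr rfl fun k _ => by push_cast; ring

/-- `(a + 1)_n = (a)_n (a + n) / a`, free of division. -/
lemma mul_poch_add_one (a : ℝ) (n : ℕ) : a * poch (a + 1) n = poch a n * (a + n) := by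
  rw [← poch_succ_left, poch_succ]

lemma eval_ascPochhammer (a : ℝ) (n : ℕ) : (ascPochhammer ℝ n).eval a = poch a n := by
  induction n with
  | zero => simp
  | succ n ih => rw [ascPochhammer_succ_eval, ih, poch_succ]

lemma Gamma_add_natCast {a : ℝ} (ha : 0 < a) (n : ℕ) :
    Real.Gamma (a + n) = poch a n * Real.Gamma a := by
  induction n with
  | zero => simp
  | succ n ih =>
    rw [poch_succ, Nat.cast_succ, ← add_assoc, Real.Gamma_add_one (by positivity), ih]
    ring

lemma poch_eq_Gamma_div {a : ℝ} (ha : 0 < a) (n : ℕ) :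
    poch a n = Real.Gamma (a + n) / Real.Gamma a := by
  rw [Gamma_add_natCast ha, mul_div_cancel_right₀ _ (Real.Gamma_pos_of_pos ha).ne']

/-- `(-m)_k / k! = (-1)ᵏ (m choose k)`. -/
lemma poch_neg_natCast (m k : ℕ) :
    poch (-(m : ℝ)) k = (-1) ^ k * (m.choose k : ℝ) * (k.factorial : ℝ) := by
  rw [mul_assoc, ← Nat.cast_mul, mul_comm (m.choose k), ← Nat.descFactorial_eq_factorial_mul_choose]
  induction k with
  | zero => simp
  | succ k ih =>
    rw [poch_succ, ih, Nat.descFactorial_succ]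
    rcases lt_or_ge m k with h | h
    · simp [Nat.descFactorial_of_lt h]
    · push_cast [Nat.cast_sub h]
      ring

/-- Reversal of a Pochhammer symbol: `(1 - m - b)_i (b)_j = (-1)ⁱ (b)_m` when `i + j = m`. -/
lemma poch_reverse (b : ℝ) (i j : ℕ) :
    poch (1 - ((i + j : ℕ) : ℝ) - b) i * poch b j = (-1) ^ i * poch b (i + j) := by
  induction i generalizing j with
  | zero => simp
  | succ i ih =>
    have h := ih (j + 1)
    rw [show i + (j + 1) = i + 1 + j by ring] at h
    rw [poch_succ]
    rw [poch_succ] at h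
    rw [pow_succ, mul_neg_one, neg_mul, ← h]
    push_cast
    ring

/-! ### Terminating hypergeometric series -/

/-- The polynomial `₂F₁(-m, b; c; x)`, written with binomial coefficients in place of
`(-m)_k / k!`. -/
noncomputable def hypPoly (m : ℕ) (b c x : ℝ) : ℝ :=
  ∑ k ∈ range (m + 1), (-1) ^ k * (m.choose k : ℝ) * poch b k / poch c k * x ^ k

lemma hypPoly_eq_sum_range {m n : ℕ} (h : m < n) (b c x : ℝ) :
    hypPoly m b c x =
      ∑ k ∈ range n, (-1) ^ k * (m.choose k : ℝ) * poch b k / poch c k * x ^ k := by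
  refine sum_subset (range_subset_range.2 h) fun k _ hk => ?_
  rw [Nat.choose_eq_zero_of_lt (by simpa using hk)]
  simp

lemma ordinaryHypergeometric_neg_natCast {A : Type*} [Ring A] [Algebra ℝ A] [TopologicalSpace A]
    [IsTopologicalRing A] (m : ℕ) (b c : ℝ) (x : A) :
    ordinaryHypergeometric (-(m : ℝ)) b c x =
      ∑ k ∈ range (m + 1), ((-1) ^ k * (m.choose k : ℝ) * poch b k / poch c k) • x ^ k := by
  rw [ordinaryHypergeometric_eq_tsum]
  have key : ∀ k : ℕ, ((k.factorial : ℝ)⁻¹ * (ascPochhammer ℝ k).eval (-(m : ℝ)) *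
      (ascPochhammer ℝ k).eval b * ((ascPochhammer ℝ k).eval c)⁻¹) =
      (-1) ^ k * (m.choose k : ℝ) * poch b k / poch c k := fun k => by
    have := Nat.factorial_ne_zero k
    simp only [eval_ascPochhammer, poch_neg_natCast]
    field_simp
  simp only [key]
  refine tsum_eq_sum fun k hk => ?_
  rw [Nat.choose_eq_zero_of_lt (by simpa using hk)]
  simp

lemma ordinaryHypergeometric_eq_hypPoly (m : ℕ) (b c x : ℝ) :
    ordinaryHypergeometric (-(m : ℝ)) b c x = hypPoly m b c x := by
  simp [ordinaryHypergeometric_neg_natCast, hypPoly]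

/-- The contiguous relation `b F(b + 1) - a F(a + 1) = (b - a) F` with `a = -(m + 1)`. -/
lemma hypPoly_contiguous (m : ℕ) (b c x : ℝ) :
    b * hypPoly (m + 1) (b + 1) c x + (m + 1) * hypPoly m b c x =
      (b + (m + 1)) * hypPoly (m + 1) b c x := by
  rw [hypPoly_eq_sum_range (show m < m + 1 + 1 by omega)]
  simp only [hypPoly, mul_sum, ← sum_add_distrib]
  refine sum_congr rfl fun k hk => ?_
  have hk' : k ≤ m + 1 := by simpa [Nat.lt_succ_iff] using hk
  have h1 : (m.choose k : ℝ) * (m + 1) = ((m + 1).choose k : ℝ) * (m + 1 - k) := by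
    have := Nat.choose_mul_succ_eq m k
    rw [← Nat.cast_inj (R := ℝ)] at this
    push_cast [Nat.cast_sub hk'] at this
    exact this
  have h2 := mul_poch_add_one b k
  calc _ = (-1) ^ k * ((m + 1).choose k : ℝ) * (b * poch (b + 1) k) / poch c k * x ^ k +
        (-1) ^ k * ((m.choose k : ℝ) * (m + 1)) * poch b k / poch c k * x ^ k := by ring
    _ = _ := by rw [h1, h2]; ring

/-- The forward shift `F(-m-1, b + 1; c) - F(-m, b; c) = -(m + 1 + b) (x / c) F(-m, b + 1; c + 1)`. -/
lemma hypPoly_sub_hypPoly (m : ℕ) (b x : ℝ) {c : ℝ} (hc : 0 < c) :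
    hypPoly (m + 1) (b + 1) c x - hypPoly m b c x =
      -((m + 1 + b) * (x / c) * hypPoly m (b + 1) (c + 1) x) := by
  rw [hypPoly_eq_sum_range (show m < m + 1 + 1 by omega)]
  simp only [hypPoly, ← sum_sub_distrib, mul_sum, ← sum_neg_distrib]
  rw [sum_range_succ']
  simp only [pow_zero, Nat.choose_zero_right, poch_zero, sub_self, add_zero]
  refine sum_congr rfl fun k hk => ?_
  have hk' : k ≤ m := by simpa [Nat.lt_succ_iff] using hk
  have h1 : (m.choose (k + 1) : ℝ) * (k + 1) = (m.choose k : ℝ) * (m - k) := by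
    have := Nat.choose_succ_right_eq m k
    rw [← Nat.cast_inj (R := ℝ)] at this
    push_cast [Nat.cast_sub hk'] at this
    exact this
  have h1' : (m.choose (k + 1) : ℝ) = (m.choose k : ℝ) * (m - k) / (k + 1) := by
    field_simp; linarith
  have h2 : ((m + 1).choose (k + 1) : ℝ) = m.choose k * (m + 1) / (k + 1) := by
    rw [Nat.choose_succ_succ, Nat.cast_add, h1']
    field_simp
    ring
  rw [h1', h2, poch_succ_left c, poch_succ_left b, poch_succ]
  have := poch_ne_zero (show 0 < c + 1 by positivity) k
  have := hc.ne'
  field_simp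
  ring

/-- A three-term contiguous relation changing the lower parameter. -/
lemma hypPoly_contiguous_lower (m : ℕ) (b x : ℝ) {c : ℝ} (hc : 0 < c) :
    (m + 1 + c) * b * hypPoly (m + 1) (b + 1) (c + 1) x -
        (m + 1) * (b - c) * hypPoly m b (c + 1) x =
      c * (m + 1 + b) * hypPoly (m + 1) b c x := by
  rw [hypPoly_eq_sum_range (show m < m + 1 + 1 by omega)]
  simp only [hypPoly, mul_sum, ← sum_sub_distrib]
  refine sum_congr rfl fun k hk => ?_
  have hk' : k ≤ m + 1 := by simpa [Nat.lt_succ_iff] using hk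
  have h1 : (m.choose k : ℝ) * (m + 1) = ((m + 1).choose k : ℝ) * (m + 1 - k) := by
    have := Nat.choose_mul_succ_eq m k
    rw [← Nat.cast_inj (R := ℝ)] at this
    push_cast [Nat.cast_sub hk'] at this
    exact this
  have h2 := mul_poch_add_one b k
  have h3 : c / poch c k = (c + k) / poch (c + 1) k := by
    rw [div_eq_div_iff (poch_ne_zero hc k) (poch_ne_zero (by positivity) k), mul_poch_add_one]
    ring
  calc _ = (-1) ^ k * ((m + 1).choose k : ℝ) * (m + 1 + c) * (b * poch (b + 1) k) /
          poch (c + 1) k * x ^ k -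
        (-1) ^ k * ((m.choose k : ℝ) * (m + 1)) * (b - c) * poch b k / poch (c + 1) k * x ^ k := by
        ring
    _ = (-1) ^ k * ((m + 1).choose k : ℝ) * poch b k * (m + 1 + b) *
          ((c + k) / poch (c + 1) k) * x ^ k := by rw [h1, h2]; ring
    _ = _ := by rw [← h3]; ring

/-! ### An inverse pair -/

/-- The summand `(-1)^(m + k) (m choose k) / m! · (m + σ - 1)_k / ((m + σ - 1)_m (n - m)!
(σ + 2 m)_(n - m))` of the inverse pair relating powers to Jacobi polynomials, rewritten with
Gamma functions. -/
lemma inversePair_summand {σ : ℝ} (hσ : 1 < σ) {n m : ℕ} (hm : m ≤ n) (k : ℕ) :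
    (-1) ^ m / (m.factorial * poch (m + σ - 1) m) *
        ((-1) ^ k * (m.choose k : ℝ) * poch (m + σ - 1) k) /
        ((n - m).factorial * poch (σ + 2 * m) (n - m)) =
      (-1) ^ (m + k) * (m.choose k : ℝ) / m.factorial * (2 * m + σ - 1) *
        Real.Gamma (m + k + σ - 1) / (Real.Gamma (σ + m + n) * (n - m).factorial) := by
  have h1 : 0 < m + σ - 1 := by have : (0 : ℝ) ≤ m := m.cast_nonneg; linarith
  have h2 : 0 < σ + 2 * m := by positivity
  have h3 : 0 < 2 * m + σ - 1 := by have : (0 : ℝ) ≤ m := m.cast_nonneg; linarith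
  have h4 : Real.Gamma (σ + 2 * m) = (2 * m + σ - 1) * Real.Gamma (2 * m + σ - 1) := by
    rw [← Real.Gamma_add_one h3.ne']; congr 1; ring
  rw [poch_eq_Gamma_div h1, poch_eq_Gamma_div h1, poch_eq_Gamma_div h2, h4, Nat.cast_sub hm,
    show m + σ - 1 + (m : ℝ) = 2 * m + σ - 1 by ring,
    show m + σ - 1 + (k : ℝ) = m + k + σ - 1 by ring,
    show σ + 2 * m + ((n : ℝ) - m) = σ + m + n by ring]
  have g1 := (Real.Gamma_pos_of_pos h1).ne'
  have g2 := (Real.Gamma_pos_of_pos h3).ne'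
  have g3 := (Real.Gamma_pos_of_pos (show 0 < σ + m + n by positivity)).ne'
  have g4 := Nat.factorial_ne_zero m
  have g5 := Nat.factorial_ne_zero (n - m)
  have g6 := h3.ne'
  field_simp
  ring

/-- Partial sums of the inverse pair telescope when `k < n`. The factor `(n - M) / (n - M)!` stands
for `1 / (n - M - 1)!`, so that the full sum, `M = n`, vanishes. -/
lemma inversePair_partialSum {σ : ℝ} (hσ : 1 < σ) {n k : ℕ} (hk : k < n) {M : ℕ} (hM : M ≤ n) :
    ∑ m ∈ range (M + 1), (-1) ^ (m + k) * (m.choose k : ℝ) / m.factorial * (2 * m + σ - 1) *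
        Real.Gamma (m + k + σ - 1) / (Real.Gamma (σ + m + n) * (n - m).factorial) =
      (-1) ^ (M + k) * (M.choose k : ℝ) / M.factorial * Real.Gamma (M + k + σ) * (n - M) /
        ((n - k) * Real.Gamma (σ + M + n) * (n - M).factorial) := by
  have hnk : (n : ℝ) - k ≠ 0 := by
    have : (k : ℝ) < n := by exact_mod_cast hk
    linarith
  induction M with
  | zero =>
    rcases Nat.eq_zero_or_pos k with rfl | hk0
    · have : Real.Gamma σ = (σ - 1) * Real.Gamma (σ - 1) := by
        rw [← Real.Gamma_add_one (by linarith)]; congr 1; ring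
      have hn : (n : ℝ) ≠ 0 := by simpa using hnk
      have g3 := (Real.Gamma_pos_of_pos (show 0 < σ + n by positivity)).ne'
      have g5 := Nat.factorial_ne_zero n
      simp [this]
      field_simp
    · simp [Nat.choose_eq_zero_of_lt hk0]
  | succ M ih =>
    rw [sum_range_succ, ih (by omega)]
    obtain ⟨d, rfl⟩ := Nat.exists_eq_add_of_le hM
    rw [show M + 1 + d - M = d + 1 by omega, show M + 1 + d - (M + 1) = d by omega,
      Nat.factorial_succ d, Nat.factorial_succ M]
    have hu : 0 < M + σ := by positivity
    have e1 : Real.Gamma (((M + 1 : ℕ) : ℝ) + k + σ) =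
        (M + k + σ) * Real.Gamma (M + k + σ) := by
      rw [← Real.Gamma_add_one (by positivity)]; congr 1; push_cast; ring
    have e2 : Real.Gamma (σ + ((M + 1 : ℕ) : ℝ) + ((M + 1 + d : ℕ) : ℝ)) =
        (σ + M + (M + 1 + d)) * Real.Gamma (σ + M + (M + 1 + d)) := by
      rw [← Real.Gamma_add_one (by positivity)]; congr 1; push_cast; ring
    have e3 : ((M + 1 : ℕ) : ℝ) + k + σ - 1 = M + k + σ := by push_cast; ring
    have hc : (M.choose k : ℝ) * (M + 1) = ((M + 1).choose k : ℝ) * (M + 1 - k) := by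
      rcases lt_or_ge (M + 1) k with h | h
      · simp [Nat.choose_eq_zero_of_lt h, Nat.choose_eq_zero_of_lt (show M < k by omega)]
      · have := Nat.choose_mul_succ_eq M k
        rw [← Nat.cast_inj (R := ℝ)] at this
        push_cast [Nat.cast_sub h] at this
        exact this
    have hc' : (M.choose k : ℝ) = ((M + 1).choose k : ℝ) * (M + 1 - k) / (M + 1) := by
      rw [← hc]; field_simp
    rw [e1, e2, e3, hc']
    have g1 := (Real.Gamma_pos_of_pos (show 0 < σ + M + (M + 1 + d) by positivity)).ne'
    have g4 := Nat.factorial_ne_zero M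
    have g5 := Nat.factorial_ne_zero d
    have g6 : σ + M + (M + 1 + d) ≠ 0 := by positivity
    push_cast at hnk ⊢
    rw [show (-1 : ℝ) ^ (M + 1 + k) = -(-1) ^ (M + k) by ring]
    field_simp
    ring

/-- The inverse pair: the array `(-1)^(m + k) (m + σ - 1)_k / ((m - k)! (m + σ - 1)_m)` is a left
inverse of `1 / ((n - m)! (σ + 2 m)_(n - m))`, up to a diagonal factor. -/
lemma inversePair {σ : ℝ} (hσ : 1 < σ) {n k : ℕ} (hk : k ≤ n) :
    ∑ m ∈ range (n + 1), (-1) ^ m / (m.factorial * poch (m + σ - 1) m) *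
        ((-1) ^ k * (m.choose k : ℝ) * poch (m + σ - 1) k) /
        ((n - m).factorial * poch (σ + 2 * m) (n - m)) =
      if k = n then 1 / (n.factorial : ℝ) else 0 := by
  rw [sum_congr rfl fun m hm =>
    inversePair_summand hσ (show m ≤ n by simpa [Nat.lt_succ_iff] using hm) k]
  split_ifs with h
  · subst h
    rw [sum_range_succ, sum_eq_zero fun m hm => by
      rw [Nat.choose_eq_zero_of_lt (by simpa using hm)]; simp, zero_add]
    have : Real.Gamma (σ + k + k) = (2 * k + σ - 1) * Real.Gamma (k + k + σ - 1) := by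
      rw [show k + k + σ - 1 = 2 * k + σ - 1 by ring, ← Real.Gamma_add_one
        (by have : (0 : ℝ) ≤ k := k.cast_nonneg; linarith)]
      congr 1; ring
    have g := (Real.Gamma_pos_of_pos (show 0 < σ + k + k by positivity)).ne'
    rw [show (-1 : ℝ) ^ (k + k) = 1 by rw [← two_mul]; simp, Nat.choose_self, Nat.sub_self, mul_assoc,
      ← this]
    field_simp
    simp
  · rw [inversePair_partialSum hσ (by omega) le_rfl]
    simp

/-- Expansion of a monomial in Jacobi polynomials. -/
lemma sum_hypPoly_eq_pow {σ : ℝ} (hσ : 1 < σ) (c v : ℝ) (n : ℕ) :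
    ∑ m ∈ range (n + 1), (-1) ^ m / (m.factorial * poch (m + σ - 1) m) *
        hypPoly m (m + σ - 1) c v / ((n - m).factorial * poch (σ + 2 * m) (n - m)) =
      v ^ n / (n.factorial * poch c n) := by
  rw [sum_congr rfl fun m hm => by
    rw [hypPoly_eq_sum_range (show m < n + 1 by simpa using hm), mul_sum, sum_div], sum_comm]
  have key : ∀ k ∈ range (n + 1), ∑ m ∈ range (n + 1),
      (-1) ^ m / (m.factorial * poch (m + σ - 1) m) *
        ((-1) ^ k * (m.choose k : ℝ) * poch (m + σ - 1) k / poch c k * v ^ k) /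
        ((n - m).factorial * poch (σ + 2 * m) (n - m)) =
      (if k = n then 1 / (n.factorial : ℝ) else 0) * (v ^ k / poch c k) := fun k hk => by
    rw [← inversePair hσ (show k ≤ n by simpa [Nat.lt_succ_iff] using hk), sum_mul]
    exact sum_congr rfl fun m _ => by ring
  rw [sum_congr rfl key]
  simp only [ite_mul, zero_mul, sum_ite_eq', mem_range, Nat.lt_succ_self, if_true]
  rw [div_mul_div_comm, one_mul]

/-! ### Harmonic polynomials for the Bessel operator in two variables -/

/-- Multiplication by `x + y` on a formal series `∑ c i j xⁱ yʲ`, given by its coefficients. -/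
def mulAdd (c : ℕ → ℕ → ℝ) : ℕ → ℕ → ℝ
  | 0, 0 => 0
  | i + 1, 0 => c i 0
  | 0, j + 1 => c 0 j
  | i + 1, j + 1 => c i (j + 1) + c (i + 1) j

/-- The operator `x ∂x² + a ∂x + y ∂y² + b ∂y` on coefficients of a formal series in `x`, `y`. -/
def besselOp (a b : ℝ) (c : ℕ → ℕ → ℝ) (i j : ℕ) : ℝ :=
  (i + 1) * (i + a) * c (i + 1) j + (j + 1) * (j + b) * c i (j + 1)

/-- Coefficients of the homogeneous polynomial of degree `m` annihilated by `besselOp a b`,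
normalized so that the coefficient of `yᵐ` is `1`. -/
noncomputable def harm (a b : ℝ) (m i j : ℕ) : ℝ :=
  if i + j = m then
    (-1) ^ i * m.factorial * poch b m / (i.factorial * j.factorial * poch a i * poch b j)
  else 0

lemma besselOp_mulAdd (a b : ℝ) (c : ℕ → ℕ → ℝ) (i j : ℕ) :
    besselOp a b (mulAdd c) i j =
      mulAdd (besselOp a b c) i j + (2 * (i + j) + a + b) * c i j := by
  cases i <;> cases j <;> simp [besselOp, mulAdd] <;> ring

lemma mulAdd_mul (r : ℝ) (c : ℕ → ℕ → ℝ) :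
    mulAdd (fun i j => r * c i j) = fun i j => r * mulAdd c i j := by
  funext i j
  cases i <;> cases j <;> simp [mulAdd]
  ring

lemma mulAdd_iterate_harm_eq_zero (a b : ℝ) (m k : ℕ) {i j : ℕ} (h : i + j ≠ m + k) :
    mulAdd^[k] (harm a b m) i j = 0 := by
  induction k generalizing i j with
  | zero => simp_all [harm]
  | succ k ih =>
    rw [Function.iterate_succ_apply']
    cases i <;> cases j <;> simp only [mulAdd]
    · exact ih (by omega)
    · exact ih (by omega)
    · rw [ih (by omega), ih (by omega), add_zero]

lemma mulAdd_iterate_harm_zero_left {a b : ℝ} (hb : 0 < b) (m k : ℕ) :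
    mulAdd^[k] (harm a b m) 0 (m + k) = 1 := by
  induction k with
  | zero =>
    simp [harm, poch_ne_zero hb m, Nat.factorial_ne_zero m]
  | succ k ih => rw [Function.iterate_succ_apply', ← add_assoc, mulAdd, ih]

lemma besselOp_harm {a b : ℝ} (ha : 0 < a) (hb : 0 < b) (m i j : ℕ) :
    besselOp a b (harm a b m) i j = 0 := by
  by_cases h : i + j + 1 = m
  · have g1 := poch_ne_zero ha i
    have g2 := poch_ne_zero hb j
    have g3 := Nat.factorial_ne_zero i
    have g4 := Nat.factorial_ne_zero j
    have : (i : ℝ) + a ≠ 0 := by positivity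
    have : (j : ℝ) + b ≠ 0 := by positivity
    simp only [besselOp, harm, show i + 1 + j = m by omega, show i + (j + 1) = m by omega, if_true,
      poch_succ, Nat.factorial_succ]
    push_cast
    rw [add_comm a, add_comm b]
    field_simp
    ring
  · simp [besselOp, harm, show i + 1 + j ≠ m by omega, show i + (j + 1) ≠ m by omega]

/-- The `sl₂` lowering relation for powers of `x + y` times a harmonic polynomial. -/
lemma besselOp_mulAdd_iterate_harm {a b : ℝ} (ha : 0 < a) (hb : 0 < b) (m k i j : ℕ) :
    besselOp a b (mulAdd^[k + 1] (harm a b m)) i j =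
      (k + 1) * (a + b + 2 * m + k) * mulAdd^[k] (harm a b m) i j := by
  induction k generalizing i j with
  | zero =>
    simp only [zero_add, Function.iterate_one, Function.iterate_zero, id, besselOp_mulAdd]
    rw [show besselOp a b (harm a b m) = fun _ _ => 0 * 0 from by
      funext i j; rw [besselOp_harm ha hb, zero_mul], mulAdd_mul]
    by_cases h : i + j = m
    · rw [← h]; push_cast; ring
    · simp [harm, h]
  | succ k ih =>
    rw [Function.iterate_succ_apply' mulAdd (k + 1), besselOp_mulAdd,
      show besselOp a b (mulAdd^[k + 1] (harm a b m)) = fun i j =>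
        (k + 1) * (a + b + 2 * m + k) * mulAdd^[k] (harm a b m) i j from by funext i j; exact ih i j,
      mulAdd_mul, ← Function.iterate_succ_apply' mulAdd k]
    by_cases h : i + j = m + (k + 1)
    · have : (i : ℝ) + j = m + (k + 1) := by exact_mod_cast h
      rw [this]; push_cast; ring
    · simp [mulAdd_iterate_harm_eq_zero a b m (k + 1) h]

/-- An array fixed by `besselOp a b` is determined by its coefficients with `i = 0`. -/
lemma eq_of_besselOp_fixed {a b : ℝ} (ha : 0 < a) {c d : ℕ → ℕ → ℝ}
    (hc : ∀ i j, besselOp a b c i j = c i j) (hd : ∀ i j, besselOp a b d i j = d i j)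
    (h0 : ∀ j, c 0 j = d 0 j) (i j : ℕ) : c i j = d i j := by
  induction i generalizing j with
  | zero => exact h0 j
  | succ i ih =>
    have h := (hc i j).trans ((ih j).trans (hd i j).symm)
    simp only [besselOp, ih (j + 1), add_left_inj] at h
    exact mul_left_cancel₀ (by positivity) h

/-- The coefficient form of the product formula: the monomials `(1 - v)ⁱ vʲ`, suitably normalized,
expanded in Jacobi polynomials in `v` with coefficients built from `harm`. -/
lemma coeff_product_formula {a b : ℝ} (ha : 0 < a) (hb : 0 < b) (hab : 1 < a + b) (v : ℝ)
    (i j : ℕ) :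
    ∑ m ∈ range (i + j + 1), (-1) ^ m / (m.factorial * poch (m + (a + b) - 1) m) *
        hypPoly m (m + (a + b) - 1) b v /
        ((i + j - m).factorial * poch (a + b + 2 * m) (i + j - m)) *
        mulAdd^[i + j - m] (harm a b m) i j =
      (1 - v) ^ i / (i.factorial * poch a i) * (v ^ j / (j.factorial * poch b j)) := by
  refine eq_of_besselOp_fixed (a := a) (b := b) ha
    (c := fun i j => ∑ m ∈ range (i + j + 1), (-1) ^ m / (m.factorial * poch (m + (a + b) - 1) m) *
        hypPoly m (m + (a + b) - 1) b v /
        ((i + j - m).factorial * poch (a + b + 2 * m) (i + j - m)) *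
        mulAdd^[i + j - m] (harm a b m) i j)
    (d := fun i j => (1 - v) ^ i / (i.factorial * poch a i) * (v ^ j / (j.factorial * poch b j)))
    (fun i j => ?_) (fun i j => ?_) (fun j => ?_) i j
  · simp only [besselOp, show i + 1 + j = i + j + 1 by omega, show i + (j + 1) = i + j + 1 by omega,
      mul_sum, ← sum_add_distrib]
    rw [sum_range_succ]
    have hlast := besselOp_harm ha hb (i + j + 1) i j
    simp only [besselOp] at hlast
    rw [show ∀ A : ℝ, (i + 1) * (i + a) * (A * mulAdd^[i + j + 1 - (i + j + 1)]
        (harm a b (i + j + 1)) (i + 1) j) + (j + 1) * (j + b) * (A * mulAdd^[i + j + 1 - (i + j + 1)]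
        (harm a b (i + j + 1)) i (j + 1)) = 0 from fun A => by
      rw [Nat.sub_self, Function.iterate_zero, id]
      linear_combination A * hlast, add_zero]
    refine sum_congr rfl fun m hm => ?_
    have hm' : m ≤ i + j := by simpa [Nat.lt_succ_iff] using hm
    obtain ⟨d, hd⟩ := Nat.exists_eq_add_of_le hm'
    rw [show i + j + 1 - m = d + 1 by omega, show i + j - m = d by omega, poch_succ,
      Nat.factorial_succ]
    have hs := besselOp_mulAdd_iterate_harm ha hb m d i j
    simp only [besselOp] at hs
    have g1 := poch_ne_zero (show 0 < a + b + 2 * m by positivity) d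
    have g2 := Nat.factorial_ne_zero d
    have g3 : a + b + 2 * m + d ≠ 0 := by positivity
    calc _ = (-1) ^ m / (m.factorial * poch (m + (a + b) - 1) m) * hypPoly m (m + (a + b) - 1) b v /
          (((d + 1) * d.factorial : ℕ) * (poch (a + b + 2 * m) d * (a + b + 2 * m + d))) *
          ((i + 1) * (i + a) * mulAdd^[d + 1] (harm a b m) (i + 1) j +
            (j + 1) * (j + b) * mulAdd^[d + 1] (harm a b m) i (j + 1)) := by ring
      _ = _ := by
        rw [hs]
        push_cast
        have : poch (m + (a + b) - 1) m ≠ 0 := poch_ne_zero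
          (by have : (0 : ℝ) ≤ m := m.cast_nonneg; linarith) m
        field_simp
  · have g1 := poch_ne_zero ha i
    have g2 := poch_ne_zero hb j
    have g3 := Nat.factorial_ne_zero i
    have g4 := Nat.factorial_ne_zero j
    have : a + (i : ℝ) ≠ 0 := by positivity
    have : b + (j : ℝ) ≠ 0 := by positivity
    simp only [besselOp, poch_succ, Nat.factorial_succ]
    push_cast
    rw [add_comm _ a, add_comm _ b]
    field_simp
    ring
  · simp only [zero_add, pow_zero, Nat.factorial_zero, poch_zero, Nat.cast_one, mul_one, div_one,
      one_mul]
    rw [← sum_hypPoly_eq_pow hab b v j]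
    refine sum_congr rfl fun m hm => ?_
    have hm' : m ≤ j := by simpa [Nat.lt_succ_iff] using hm
    have := mulAdd_iterate_harm_zero_left (a := a) hb m (j - m)
    rw [show m + (j - m) = j by omega] at this
    rw [this, mul_one]

/-! ### Growth estimates -/

lemma poch_le_pow_mul_factorial {a : ℝ} (ha : 0 < a) (n : ℕ) :
    poch a n ≤ (a + 1) ^ n * n.factorial := by
  induction n with
  | zero => simp
  | succ n ih =>
    rw [poch_succ, pow_succ, Nat.factorial_succ]
    push_cast
    calc poch a n * (a + n) ≤ ((a + 1) ^ n * n.factorial) * ((a + 1) * (n + 1)) := by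
          gcongr
          nlinarith [mul_nonneg ha.le (n.cast_nonneg (α := ℝ))]
      _ = _ := by ring

lemma factorial_le_pow_mul_poch {a : ℝ} (ha : 0 < a) (n : ℕ) :
    (n.factorial : ℝ) ≤ (1 + 1 / a) ^ n * poch a n := by
  induction n with
  | zero => simp
  | succ n ih =>
    rw [poch_succ, pow_succ, Nat.factorial_succ]
    push_cast
    have : (n : ℝ) + 1 ≤ (1 + 1 / a) * (a + n) := by
      have h1 : (1 + 1 / a) * (a + n) = n + 1 + a + n / a := by field_simp; ring
      have h2 : 0 ≤ n / a := by positivity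
      rw [h1]; linarith
    calc ((n : ℝ) + 1) * n.factorial ≤ ((1 + 1 / a) * (a + n)) * ((1 + 1 / a) ^ n * poch a n) := by
          gcongr
      _ = _ := by ring

lemma inv_poch_le {a : ℝ} (ha : 0 < a) (n : ℕ) : (poch a n)⁻¹ ≤ (1 + 1 / a) ^ n := by
  have h0 := poch_pos ha n
  rw [inv_le_iff_one_le_mul₀ h0]
  refine le_trans ?_ (factorial_le_pow_mul_poch ha n)
  exact_mod_cast n.factorial_pos

lemma one_le_poch {a : ℝ} (ha : 1 ≤ a) (n : ℕ) : 1 ≤ poch a n := by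
  induction n with
  | zero => simp
  | succ n ih =>
    rw [poch_succ]
    exact one_le_mul_of_one_le_of_one_le ih (by have : (0 : ℝ) ≤ n := n.cast_nonneg; linarith)

lemma poch_le_poch {a : ℝ} (ha : 1 ≤ a) {k n : ℕ} (h : k ≤ n) : poch a k ≤ poch a n := by
  obtain ⟨d, rfl⟩ := Nat.exists_eq_add_of_le h
  rw [poch_add]
  exact le_mul_of_one_le_right (poch_pos (by linarith) k).le
    (one_le_poch (by have : (0 : ℝ) ≤ k := k.cast_nonneg; linarith) d)

lemma abs_hypPoly_le {m : ℕ} {b c : ℝ} (hb : m = 0 ∨ 1 ≤ b) (hc : 0 < c) (x : ℝ) :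
    |hypPoly m b c x| ≤ poch b m * ((1 + 1 / c) * |x| + 1) ^ m := by
  rcases hb with rfl | hb
  · simp [hypPoly]
  rw [add_pow, mul_sum]
  refine (abs_sum_le_sum_abs _ _).trans (sum_le_sum fun k hk => ?_)
  have hk' : k ≤ m := by simpa [Nat.lt_succ_iff] using hk
  have hbk := poch_pos (show 0 < b by linarith) k
  have hck := poch_pos hc k
  rw [abs_mul, abs_div, abs_mul, abs_mul, abs_pow, abs_neg, abs_one, one_pow, one_mul, Nat.abs_cast,
    abs_of_pos hbk, abs_of_pos hck, abs_pow, one_pow, mul_one, mul_pow, div_eq_mul_inv]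
  calc (m.choose k : ℝ) * poch b k * (poch c k)⁻¹ * |x| ^ k
      ≤ (m.choose k : ℝ) * poch b m * (1 + 1 / c) ^ k * |x| ^ k := by
        gcongr
        · have := poch_pos (show 0 < b by linarith) m
          positivity
        · exact poch_le_poch hb hk'
        · exact inv_poch_le hc k
    _ = _ := by ring

/-- The harmonic polynomial of degree `m` with coefficients `harm a b m`; it is
`yᵐ ₂F₁(-m, 1 - m - b; a; -x / y)`. -/
noncomputable def harmPoly (a b : ℝ) (m : ℕ) (x y : ℂ) : ℂ :=
  ∑ p ∈ antidiagonal m, (harm a b m p.1 p.2 : ℂ) * x ^ p.1 * y ^ p.2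

lemma abs_harm_le {a b : ℝ} (ha : 0 < a) (hb : 0 < b) {m : ℕ} {p : ℕ × ℕ}
    (hp : p ∈ antidiagonal m) :
    |harm a b m p.1 p.2| ≤ (m.choose p.1 : ℝ) * (2 * (b + 1) * (1 + 1 / a) * (1 + 1 / b)) ^ m := by
  obtain ⟨i, j⟩ := p
  have hij : i + j = m := mem_antidiagonal.1 hp
  simp only [harm, hij, if_true]
  have hch : (m.factorial : ℝ) = m.choose i * i.factorial * j.factorial := by
    rw [← hij]
    rw [Nat.choose_symm_add]
    exact_mod_cast (Nat.add_choose_mul_factorial_mul_factorial i j).symm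
  have h2 : (m.choose i : ℝ) ≤ 2 ^ m := by exact_mod_cast Nat.choose_le_two_pow m i
  have hi := poch_pos ha i
  have hj := poch_pos hb j
  have hm := poch_pos hb m
  have fi : (0 : ℝ) < i.factorial := by positivity
  have fj : (0 : ℝ) < j.factorial := by positivity
  rw [abs_div, abs_mul, abs_mul, abs_pow, abs_neg, abs_one, one_pow, one_mul, Nat.abs_cast,
    abs_of_pos hm, abs_of_pos (show 0 < (i.factorial : ℝ) * j.factorial * poch a i * poch b j by
      positivity), div_le_iff₀ (by positivity)]
  have h1a : (1 : ℝ) ≤ 1 + 1 / a := by have : 0 < 1 / a := by positivity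
                                       linarith
  have h1b : (1 : ℝ) ≤ 1 + 1 / b := by have : 0 < 1 / b := by positivity
                                       linarith
  have e1 : (i.factorial : ℝ) ≤ (1 + 1 / a) ^ m * poch a i :=
    (factorial_le_pow_mul_poch ha i).trans (by gcongr; omega)
  have e2 : (j.factorial : ℝ) ≤ (1 + 1 / b) ^ m * poch b j :=
    (factorial_le_pow_mul_poch hb j).trans (by gcongr; omega)
  have e3 := poch_le_pow_mul_factorial hb m
  calc (m.factorial : ℝ) * poch b m ≤ (m.factorial : ℝ) * ((b + 1) ^ m * m.factorial) := by gcongr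
    _ = (m.choose i * i.factorial * j.factorial) * (b + 1) ^ m *
          (m.choose i * i.factorial * j.factorial) := by rw [← hch]; ring
    _ ≤ (m.choose i * i.factorial * j.factorial) * (b + 1) ^ m *
          (2 ^ m * ((1 + 1 / a) ^ m * poch a i) * ((1 + 1 / b) ^ m * poch b j)) := by gcongr
    _ = _ := by simp only [mul_pow]; ring

lemma norm_harmPoly_le {a b : ℝ} (ha : 0 < a) (hb : 0 < b) (m : ℕ) (x y : ℂ) :
    ‖harmPoly a b m x y‖ ≤
      (2 * (b + 1) * (1 + 1 / a) * (1 + 1 / b) * (‖x‖ + ‖y‖)) ^ m := by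
  rw [mul_pow, (Commute.all ‖x‖ ‖y‖).add_pow', mul_sum]
  refine (norm_sum_le _ _).trans (sum_le_sum fun p hp => ?_)
  rw [norm_mul, norm_mul, norm_pow, norm_pow, Complex.norm_real, Real.norm_eq_abs, nsmul_eq_mul]
  calc |harm a b m p.1 p.2| * ‖x‖ ^ p.1 * ‖y‖ ^ p.2 ≤
      ((m.choose p.1 : ℝ) * (2 * (b + 1) * (1 + 1 / a) * (1 + 1 / b)) ^ m) *
        ‖x‖ ^ p.1 * ‖y‖ ^ p.2 := by gcongr; exact abs_harm_le ha hb hp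
    _ = _ := by ring

/-- A sequence bounded by `K Rᵐ / m!`. -/
def FactorialDecay (d : ℕ → ℝ) : Prop :=
  ∃ K R : ℝ, 0 ≤ R ∧ ∀ m, |d m| ≤ K * R ^ m / m.factorial

lemma factorialDecay_hypPoly {c : ℝ} (hc : 0 < c) (s x : ℝ) {n : ℕ → ℕ} {b P : ℕ → ℝ}
    (hn : ∀ m, n m ≤ m) (hb : ∀ m, n m = 0 ∨ 1 ≤ b m) (hP : ∀ m, poch (b m) (n m) ≤ P m)
    (hP0 : ∀ m, 0 < P m) :
    FactorialDecay fun m =>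
      (-1) ^ m * s ^ m / (m.factorial * P m) * hypPoly (n m) (b m) c x := by
  refine ⟨1, |s| * ((1 + 1 / c) * |x| + 1), by positivity, fun m => ?_⟩
  have hPm := hP0 m
  have h1 : 1 ≤ (1 + 1 / c) * |x| + 1 := by
    have : 0 ≤ (1 + 1 / c) * |x| := by positivity
    linarith
  have h : |hypPoly (n m) (b m) c x| ≤ P m * ((1 + 1 / c) * |x| + 1) ^ m :=
    (abs_hypPoly_le (hb m) hc x).trans (mul_le_mul (hP m) (pow_le_pow_right₀ h1 (hn m))
      (by positivity) hPm.le)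
  rw [abs_mul, abs_div, abs_mul, abs_pow, abs_pow, abs_neg, abs_one, one_pow, one_mul,
    abs_of_pos (show 0 < (m.factorial : ℝ) * P m by positivity)]
  calc _ ≤ |s| ^ m / (m.factorial * P m) * (P m * ((1 + 1 / c) * |x| + 1) ^ m) := by gcongr
    _ = _ := by rw [mul_pow]; field_simp

lemma FactorialDecay.nonneg {d : ℕ → ℝ} {K R : ℝ}
    (h : ∀ m : ℕ, |d m| ≤ K * R ^ m / m.factorial) : 0 ≤ K := by
  simpa using (abs_nonneg _).trans (h 0)

lemma FactorialDecay.add {d e : ℕ → ℝ} (hd : FactorialDecay d) (he : FactorialDecay e) :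
    FactorialDecay fun m => d m + e m := by
  obtain ⟨K, R, hR, hK⟩ := hd
  obtain ⟨K', R', hR', hK'⟩ := he
  have hK0 := FactorialDecay.nonneg hK
  have hK0' := FactorialDecay.nonneg hK'
  refine ⟨K + K', max R R', le_max_of_le_left hR, fun m => ?_⟩
  calc |d m + e m| ≤ K * R ^ m / m.factorial + K' * R' ^ m / m.factorial :=
        (abs_add_le _ _).trans (add_le_add (hK m) (hK' m))
    _ ≤ K * (max R R') ^ m / m.factorial + K' * (max R R') ^ m / m.factorial := by
        gcongr
        · exact le_max_left _ _
        · exact le_max_right _ _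
    _ = _ := by ring

lemma FactorialDecay.of_abs_le {d e : ℕ → ℝ} (hd : FactorialDecay d) (A : ℝ)
    (h : ∀ m : ℕ, |e m| ≤ A * (m + 1) * |d m|) : FactorialDecay e := by
  obtain ⟨K, R, hR, hK⟩ := hd
  have hK0 := FactorialDecay.nonneg hK
  refine ⟨|A| * K, 2 * R, by positivity, fun m => (h m).trans ?_⟩
  have h2 : (m : ℝ) + 1 ≤ 2 ^ m := by exact_mod_cast Nat.lt_two_pow_self (n := m)
  calc A * (m + 1) * |d m| ≤ |A| * 2 ^ m * (K * R ^ m / m.factorial) := by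
        gcongr
        · exact le_abs_self A
        · exact hK m
    _ = _ := by rw [mul_pow]; ring

/-- Shifting the index gains a factor `m + 1`. -/
lemma FactorialDecay.shift {d : ℕ → ℝ} (hd : FactorialDecay d) :
    FactorialDecay fun m => (m + 1) * d (m + 1) := by
  obtain ⟨K, R, hR, hK⟩ := hd
  refine ⟨K * R, R, hR, fun m => ?_⟩
  have h := hK (m + 1)
  rw [abs_mul, abs_of_pos (show (0 : ℝ) < m + 1 by positivity)]
  calc ((m : ℝ) + 1) * |d (m + 1)| ≤ (m + 1) * (K * R ^ (m + 1) / (m + 1).factorial) := by gcongr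
    _ = _ := by
      rw [Nat.factorial_succ, pow_succ]
      push_cast
      field_simp

/-- Products of a factorially decaying sequence, the harmonic polynomials, and the terms of
`₀F₁(-; t + 2 m; X)` are summable in both indices. -/
lemma FactorialDecay.summable_prod {d : ℕ → ℝ} (hd : FactorialDecay d) {a b : ℝ} (ha : 0 < a)
    (hb : 0 < b) {t : ℝ} (ht : 1 ≤ t) (x y X : ℂ) :
    Summable fun p : ℕ × ℕ => (d p.1 : ℂ) * harmPoly a b p.1 x y *
      (X ^ p.2 / ((poch (t + 2 * p.1) p.2 : ℂ) * (p.2.factorial : ℂ))) := by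
  obtain ⟨K, R, hR, hK⟩ := hd
  obtain ⟨S, hS0, hS⟩ : ∃ S : ℝ, 0 ≤ S ∧ ∀ m, ‖harmPoly a b m x y‖ ≤ S ^ m :=
    ⟨_, by positivity, fun m => norm_harmPoly_le ha hb m x y⟩
  have h := ((Real.summable_pow_div_factorial (R * S)).mul_left K).mul_of_nonneg
    (Real.summable_pow_div_factorial ‖X‖)
    (fun m => by
      have h0 := (abs_nonneg _).trans (hK m)
      have : K * ((R * S) ^ m / m.factorial) = K * R ^ m / m.factorial * S ^ m := by
        rw [mul_pow]; ring
      change 0 ≤ K * ((R * S) ^ m / m.factorial)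
      rw [this]
      positivity) (fun k => by simp only [Pi.zero_apply]; positivity)
  refine Summable.of_norm_bounded h fun p => ?_
  have hp : 1 ≤ poch (t + 2 * p.1) p.2 :=
    one_le_poch (by have : (0 : ℝ) ≤ p.1 := p.1.cast_nonneg; linarith) _
  rw [norm_mul, norm_mul, norm_div, norm_mul, Complex.norm_real, Complex.norm_real, norm_pow,
    Complex.norm_natCast, Real.norm_eq_abs, Real.norm_eq_abs,
    abs_of_pos (show 0 < poch (t + 2 * p.1) p.2 by linarith)]
  have e1 := hK p.1
  have e2 := hS p.1
  have e3 : ‖X‖ ^ p.2 / (poch (t + 2 * p.1) p.2 * p.2.factorial) ≤ ‖X‖ ^ p.2 / p.2.factorial := by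
    gcongr
    exact le_mul_of_one_le_left (by positivity) hp
  calc |d p.1| * ‖harmPoly a b p.1 x y‖ *
        (‖X‖ ^ p.2 / (poch (t + 2 * p.1) p.2 * p.2.factorial))
      ≤ (K * R ^ p.1 / p.1.factorial) * S ^ p.1 * (‖X‖ ^ p.2 / p.2.factorial) := by
        refine mul_le_mul (mul_le_mul e1 e2 (norm_nonneg _) ((abs_nonneg _).trans e1)) e3 ?_ ?_
        · positivity
        · exact mul_nonneg ((abs_nonneg _).trans e1) (by positivity)
    _ = _ := by rw [mul_pow]; ring

lemma FactorialDecay.summable {d : ℕ → ℝ} (hd : FactorialDecay d) {a b : ℝ} (ha : 0 < a)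
    (hb : 0 < b) {t : ℝ} (ht : 1 ≤ t) (x y X : ℂ) :
    Summable fun m : ℕ => (d m : ℂ) * harmPoly a b m x y * hyp01 (t + 2 * m) X := by
  have h := (hd.summable_prod ha hb ht x y X).prod
  simpa only [tsum_mul_left, hyp01] using h

lemma summable_hyp01 {b : ℝ} (hb : 0 < b) (x : ℂ) :
    Summable fun n : ℕ => ‖x ^ n / ((poch b n : ℂ) * (n.factorial : ℂ))‖ := by
  refine Summable.of_nonneg_of_le (fun _ => norm_nonneg _) (fun n => ?_)
    (Real.summable_pow_div_factorial (‖x‖ * (1 + 1 / b)))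
  rw [norm_div, norm_mul, Complex.norm_real, norm_pow, Complex.norm_natCast, Real.norm_eq_abs,
    abs_of_pos (poch_pos hb n), mul_pow, div_mul_eq_div_div, div_eq_mul_inv (‖x‖ ^ n)]
  gcongr
  exact inv_poch_le hb n

/-! ### The product formula for two Bessel functions -/

lemma sum_antidiagonal_mulAdd (c : ℕ → ℕ → ℝ) (n : ℕ) (x y : ℂ) :
    ∑ p ∈ antidiagonal (n + 1), (mulAdd c p.1 p.2 : ℂ) * x ^ p.1 * y ^ p.2 =
      (x + y) * ∑ p ∈ antidiagonal n, (c p.1 p.2 : ℂ) * x ^ p.1 * y ^ p.2 := by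
  have h : ∀ i j, mulAdd c i j = (match i with | 0 => 0 | i + 1 => c i j) +
      (match j with | 0 => 0 | j + 1 => c i j) := fun i j => by
    cases i <;> cases j <;> simp [mulAdd]
  simp only [h, Complex.ofReal_add, add_mul, sum_add_distrib]
  congr 1
  · rw [Nat.sum_antidiagonal_succ, mul_sum]
    simp only [Complex.ofReal_zero, zero_mul, zero_add]
    exact sum_congr rfl fun p _ => by ring
  · rw [Nat.sum_antidiagonal_succ', mul_sum]
    simp only [Complex.ofReal_zero, zero_mul, zero_add]
    exact sum_congr rfl fun p _ => by ring

lemma sum_antidiagonal_mulAdd_iterate_harm (a b : ℝ) (m k : ℕ) (x y : ℂ) :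
    ∑ p ∈ antidiagonal (m + k), (mulAdd^[k] (harm a b m) p.1 p.2 : ℂ) * x ^ p.1 * y ^ p.2 =
      (x + y) ^ k * harmPoly a b m x y := by
  induction k with
  | zero => simp [harmPoly]
  | succ k ih =>
    simp only [Function.iterate_succ_apply']
    rw [← add_assoc, sum_antidiagonal_mulAdd, ih]
    ring

/-- The coefficients `(-1)ᵐ ₂F₁(-m, m + a + b - 1; b; v) / (m! (m + a + b - 1)_m)` of the product
formula. -/
noncomputable def productCoeff (a b v : ℝ) (m : ℕ) : ℝ :=
  (-1) ^ m / (m.factorial * poch (m + (a + b) - 1) m) * hypPoly m (m + (a + b) - 1) b v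

lemma factorialDecay_productCoeff {a b : ℝ} (hb : 0 < b) (hab : 1 < a + b) (v : ℝ) :
    FactorialDecay (productCoeff a b v) := by
  have hpos : ∀ m : ℕ, 0 < m + (a + b) - 1 := fun m => by
    have : (0 : ℝ) ≤ m := m.cast_nonneg
    linarith
  have h := factorialDecay_hypPoly hb 1 v (n := fun m => m) (b := fun m => m + (a + b) - 1)
    (fun _ => le_rfl) (fun m => ?_) (fun _ => le_rfl) (fun m => poch_pos (hpos m) m)
  · simp only [one_pow, mul_one] at h
    exact h
  · rcases Nat.eq_zero_or_pos m with h | h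
    · exact Or.inl h
    · have : (1 : ℝ) ≤ m := by exact_mod_cast h
      exact Or.inr (by linarith)

/-- The part of the product formula homogeneous of degree `n` in `x`, `y`. -/
lemma sum_antidiagonal_product_formula {a b : ℝ} (ha : 0 < a) (hb : 0 < b) (hab : 1 < a + b)
    (v : ℝ) (x y : ℂ) (n : ℕ) :
    ∑ p ∈ antidiagonal n, (productCoeff a b v p.1 : ℂ) * harmPoly a b p.1 x y *
        ((x + y) ^ p.2 / ((poch (a + b + 2 * p.1) p.2 : ℂ) * (p.2.factorial : ℂ))) =
      ∑ p ∈ antidiagonal n, (x * (1 - v : ℝ)) ^ p.1 / ((poch a p.1 : ℂ) * (p.1.factorial : ℂ)) *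
        ((y * v) ^ p.2 / ((poch b p.2 : ℂ) * (p.2.factorial : ℂ))) := by
  have hr : ∀ p ∈ antidiagonal n,
      (x * (1 - v : ℝ)) ^ p.1 / ((poch a p.1 : ℂ) * (p.1.factorial : ℂ)) *
        ((y * v) ^ p.2 / ((poch b p.2 : ℂ) * (p.2.factorial : ℂ))) =
      ∑ m ∈ range (n + 1), (productCoeff a b v m : ℂ) /
        (((n - m).factorial : ℂ) * (poch (a + b + 2 * m) (n - m) : ℂ)) *
        ((mulAdd^[n - m] (harm a b m) p.1 p.2 : ℂ) * x ^ p.1 * y ^ p.2) := by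
    rintro ⟨i, j⟩ hp
    obtain rfl : i + j = n := mem_antidiagonal.1 hp
    have h := congrArg (fun r : ℝ => (r : ℂ)) (coeff_product_formula ha hb hab v i j)
    simp only [Complex.ofReal_sum, Complex.ofReal_mul, Complex.ofReal_div, Complex.ofReal_pow,
      Complex.ofReal_natCast] at h
    calc _ = ((((1 - v : ℝ) : ℂ) ^ i / (i.factorial * poch a i)) *
          ((v : ℂ) ^ j / (j.factorial * poch b j))) * (x ^ i * y ^ j) := by
          simp only [mul_pow]; ring
      _ = _ := by
        rw [← h, sum_mul]
        refine sum_congr rfl fun m _ => ?_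
        simp only [productCoeff, Complex.ofReal_mul, Complex.ofReal_div, Complex.ofReal_pow,
          Complex.ofReal_natCast]
        ring
  rw [sum_congr rfl hr, sum_comm, Nat.sum_antidiagonal_eq_sum_range_succ (fun m k =>
    (productCoeff a b v m : ℂ) * harmPoly a b m x y *
      ((x + y) ^ k / ((poch (a + b + 2 * m) k : ℂ) * (k.factorial : ℂ))))]
  refine sum_congr rfl fun m hm => ?_
  have hm' : m ≤ n := by simpa [Nat.lt_succ_iff] using hm
  have h := sum_antidiagonal_mulAdd_iterate_harm a b m (n - m) x y
  rw [show m + (n - m) = n by omega] at h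
  rw [← mul_sum, h]
  ring

/-- The product formula with unit scale: `₀F₁(a; x (1 - v)) ₀F₁(b; y v)` in harmonic polynomials
times `₀F₁(a + b + 2 m; x + y)`. -/
lemma hasSum_product_formula_unit {a b : ℝ} (ha : 0 < a) (hb : 0 < b) (hab : 1 < a + b)
    (v : ℝ) (x y : ℂ) :
    HasSum (fun m : ℕ => (productCoeff a b v m : ℂ) * harmPoly a b m x y *
        hyp01 (a + b + 2 * m) (x + y))
      (hyp01 a (x * (1 - v : ℝ)) * hyp01 b (y * v)) := by
  have hs := (factorialDecay_productCoeff hb hab v).summable_prod ha hb hab.le x y (x + y)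
  have h1 := (factorialDecay_productCoeff hb hab v).summable ha hb hab.le x y (x + y)
  convert h1.hasSum using 1
  rw [hyp01, hyp01, tsum_mul_tsum_eq_tsum_sum_antidiagonal_of_summable_norm (summable_hyp01 ha _)
    (summable_hyp01 hb _)]
  simp only [← sum_antidiagonal_product_formula ha hb hab]
  have h2 : ∀ m : ℕ, (productCoeff a b v m : ℂ) * harmPoly a b m x y *
      hyp01 (a + b + 2 * m) (x + y) = ∑' k : ℕ, (productCoeff a b v m : ℂ) * harmPoly a b m x y *
      ((x + y) ^ k / ((poch (a + b + 2 * m) k : ℂ) * (k.factorial : ℂ))) := fun m => by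
    rw [hyp01, tsum_mul_left]
  simp only [h2]
  rw [← hs.tsum_prod, ← HasAntidiagonal.sigmaAntidiagonalEquivProd.tsum_eq (_ : ℕ × ℕ → ℂ)]
  refine ((Summable.tsum_sigma' (fun n ↦ (hasSum_fintype _).summable)
    (HasAntidiagonal.sigmaAntidiagonalEquivProd.summable_iff.2 hs)).trans ?_).symm
  refine tsum_congr fun n => ?_
  rw [tsum_fintype]
  exact (Finset.sum_finset_coe (fun p : ℕ × ℕ => (productCoeff a b v p.1 : ℂ) *
    harmPoly a b p.1 x y *
    ((x + y) ^ p.2 / ((poch (a + b + 2 * p.1) p.2 : ℂ) * (p.2.factorial : ℂ)))) _)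

lemma harmPoly_mul_mul (a b : ℝ) (m : ℕ) (s x y : ℂ) :
    harmPoly a b m (x * s) (y * s) = s ^ m * harmPoly a b m x y := by
  rw [harmPoly, harmPoly, mul_sum]
  refine sum_congr rfl fun p hp => ?_
  rw [← mem_antidiagonal.1 hp, pow_add]
  ring

/-- The expansion of `₀F₁(a; x (s - q)) ₀F₁(b; y q)` in the functions
`harmPoly a b m x y · ₀F₁(a + b + 2 m; (x + y) s)`, whose coefficients are Jacobi polynomials in
`q / s`. -/
theorem hasSum_product_formula {a b : ℝ} (ha : 0 < a) (hb : 0 < b) (hab : 1 < a + b)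
    {s : ℝ} (hs : s ≠ 0) (q : ℝ) (x y : ℂ) :
    HasSum (fun m : ℕ => ((s ^ m * productCoeff a b (q / s) m : ℝ) : ℂ) * harmPoly a b m x y *
        hyp01 (a + b + 2 * m) ((x + y) * s))
      (hyp01 a (x * (s - q)) * hyp01 b (y * q)) := by
  have hs' : (s : ℂ) ≠ 0 := by exact_mod_cast hs
  convert hasSum_product_formula_unit ha hb hab (q / s) (x * s) (y * s) using 1
  · funext m
    rw [harmPoly_mul_mul, add_mul]
    push_cast
    ring
  · congr 2 <;> · push_cast; field_simp

/-! ### Pairing the even and odd Big `-1` Jacobi polynomials -/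

/-- The Big `-1` Jacobi polynomial of degree `2 m` with parameters `2 b - 1`, `2 a - 1`; here
`X = (1 - x²) / (1 - c²)` and `r = (1 - x) / (1 + c)`. For `m = 0` the truncated `m - 1` is harmless,
because of the factor `m`. -/
noncomputable def evenJacobi (a b X r : ℝ) (m : ℕ) : ℝ :=
  hypPoly m (m + (a + b)) b X + m * r / b * hypPoly (m - 1) (m + (a + b)) (b + 1) X

/-- The Big `-1` Jacobi polynomial of degree `2 m + 1`, with the conventions of `evenJacobi`. -/
noncomputable def oddJacobi (a b X r : ℝ) (m : ℕ) : ℝ :=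
  hypPoly m (m + (a + b)) b X -
    (m + (a + b)) * r / b * hypPoly m (m + (a + b) + 1) (b + 1) X

/-- The product of the normalization constants and the Big `-1` Jacobi polynomial in the term of
index `2 m`. -/
noncomputable def evenCoeff (a b s X r : ℝ) (m : ℕ) : ℝ :=
  (-1) ^ m * s ^ m / (m.factorial * poch (m + (a + b)) m) * evenJacobi a b X r m

/-- The product of the normalization constants and the Big `-1` Jacobi polynomial in the term of
index `2 m + 1`, up to the factor `-(λ₂ - c ε₁ ε₂) / 2`. -/
noncomputable def oddCoeff (a b s X r : ℝ) (m : ℕ) : ℝ :=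
  (-1) ^ m * s ^ m / (m.factorial * poch (m + (a + b)) (m + 1)) * oddJacobi a b X r m

lemma poch_pos_of_one_lt {t : ℝ} (ht : 1 < t) (m n : ℕ) : 0 < poch (m + t) n :=
  poch_pos (by positivity) n

lemma factorialDecay_evenCoeff {a b : ℝ} (hb : 0 < b) (hab : 1 < a + b) (s X r : ℝ) :
    FactorialDecay (evenCoeff a b s X r) := by
  have hm : ∀ m : ℕ, 1 ≤ m + (a + b) := fun m => by
    have : (0 : ℝ) ≤ m := m.cast_nonneg
    linarith
  have h1 := factorialDecay_hypPoly hb s X (n := fun m => m) (b := fun m => m + (a + b))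
    (P := fun m => poch (m + (a + b)) m) (fun _ => le_rfl) (fun m => Or.inr (hm m))
    (fun _ => le_rfl) (fun m => poch_pos_of_one_lt hab m m)
  have h2 := factorialDecay_hypPoly (c := b + 1) (by positivity) s X (n := fun m => m - 1)
    (b := fun m => m + (a + b)) (P := fun m => poch (m + (a + b)) m) (fun _ => Nat.sub_le _ _)
    (fun m => Or.inr (hm m)) (fun m => poch_le_poch (hm m) (Nat.sub_le _ _))
    (fun m => poch_pos_of_one_lt hab m m)
  have h3 := h1.add (h2.of_abs_le (e := fun m => m * r / b * ((-1) ^ m * s ^ m /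
    (m.factorial * poch (m + (a + b)) m) * hypPoly (m - 1) (m + (a + b)) (b + 1) X)) |r / b|
    fun m => by
      rw [abs_mul, mul_div_assoc, abs_mul, Nat.abs_cast, mul_comm (m : ℝ)]
      gcongr
      linarith)
  convert h3 using 2 with m
  rw [evenCoeff, evenJacobi]
  ring

section Combination

variable {a b : ℝ} (s X r : ℝ)

lemma evenCoeff_zero : evenCoeff a b s X r 0 = productCoeff a b X 0 := by
  simp [evenCoeff, evenJacobi, productCoeff, hypPoly]

lemma evenCoeff_succ_sub_oddCoeff (hab : 1 < a + b) (m : ℕ) :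
    evenCoeff a b s X r (m + 1) - s / (2 * m + 1 + (a + b)) * oddCoeff a b s X r m =
      s ^ (m + 1) * productCoeff a b X (m + 1) := by
  have hc := hypPoly_contiguous m (m + (a + b)) b X
  simp only [evenCoeff, oddCoeff, productCoeff, evenJacobi, oddJacobi, Nat.add_sub_cancel]
  push_cast
  rw [show (m : ℝ) + 1 + (a + b) = m + (a + b) + 1 by ring,
    show (m : ℝ) + (a + b) + 1 - 1 = m + (a + b) by ring]
  have hP : poch (m + (a + b)) (m + 1) =
      (m + (a + b)) * poch (m + (a + b) + 1) (m + 1) / (2 * m + 1 + (a + b)) := by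
    have : 2 * (m : ℝ) + 1 + (a + b) ≠ 0 := by positivity
    rw [eq_div_iff this, mul_poch_add_one]
    push_cast
    ring
  have g1 := (poch_pos (show 0 < (m : ℝ) + (a + b) + 1 by positivity) (m + 1)).ne'
  have g2 := Nat.factorial_ne_zero m
  have g3 : 2 * (m : ℝ) + 1 + (a + b) ≠ 0 := by positivity
  have g4 : (m : ℝ) + (a + b) ≠ 0 := by positivity
  rw [hP, Nat.factorial_succ, pow_succ, pow_succ]
  push_cast
  generalize hypPoly (m + 1) (m + (a + b) + 1) b X = A at *
  generalize hypPoly m (m + (a + b)) b X = B at *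
  generalize hypPoly (m + 1) (m + (a + b)) b X = C at *
  generalize hypPoly m (m + (a + b) + 1) (b + 1) X = D at *
  generalize poch (m + (a + b) + 1) (m + 1) = P at *
  have hC : C = ((m + (a + b)) * A + (m + 1) * B) / (2 * m + 1 + (a + b)) := by
    rw [eq_div_iff g3]; linear_combination -hc
  rw [hC]
  field_simp
  ring

lemma evenCoeff_succ_add_oddCoeff (hb : 0 < b) (hab : 1 < a + b) (m : ℕ) :
    (m + 1) * evenCoeff a b s X r (m + 1) +
        s * (m + (a + b)) / (2 * m + 1 + (a + b)) * oddCoeff a b s X r m =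
      s * (X - r) / b * (s ^ m * productCoeff (a + 1) (b + 1) X m) := by
  have hc := hypPoly_sub_hypPoly m (m + (a + b)) X hb
  simp only [evenCoeff, oddCoeff, productCoeff, evenJacobi, oddJacobi, Nat.add_sub_cancel]
  push_cast
  rw [show (m : ℝ) + 1 + (a + b) = m + (a + b) + 1 by ring,
    show (m : ℝ) + (a + 1 + (b + 1)) - 1 = m + (a + b) + 1 by ring]
  have hP : poch (m + (a + b)) (m + 1) = (m + (a + b)) * poch (m + (a + b) + 1) m := by
    rw [poch_succ_left]
  have g1 := (poch_pos (show 0 < (m : ℝ) + (a + b) + 1 by positivity) m).ne'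
  have g2 := Nat.factorial_ne_zero m
  have g3 : 2 * (m : ℝ) + 1 + (a + b) ≠ 0 := by positivity
  have g4 : (m : ℝ) + (a + b) ≠ 0 := by positivity
  have g5 : (m : ℝ) + (a + b) + 1 + m = 2 * m + 1 + (a + b) := by ring
  rw [hP, poch_succ, g5, Nat.factorial_succ, pow_succ, pow_succ]
  push_cast
  generalize hypPoly (m + 1) (m + (a + b) + 1) b X = A at *
  generalize hypPoly m (m + (a + b)) b X = B at *
  generalize hypPoly m (m + (a + b) + 1) (b + 1) X = D at *
  generalize poch (m + (a + b) + 1) m = P at *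
  have hA : A = B - (m + 1 + (m + (a + b))) * (X / b) * D := by linear_combination hc
  rw [hA]
  field_simp
  ring

lemma evenCoeff_sub_oddCoeff (hb : 0 < b) (hab : 1 < a + b) (m : ℕ) :
    evenCoeff a b s X r m / (2 * m + (a + b)) - oddCoeff a b s X r m =
      r / b * (s ^ m * productCoeff a (b + 1) X m) := by
  simp only [evenCoeff, oddCoeff, productCoeff, evenJacobi, oddJacobi]
  rw [show (m : ℝ) + (a + (b + 1)) - 1 = m + (a + b) by ring]
  have hc : (m + (a + b)) * hypPoly m (m + (a + b) + 1) (b + 1) X +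
      m * hypPoly (m - 1) (m + (a + b)) (b + 1) X =
      (2 * m + (a + b)) * hypPoly m (m + (a + b)) (b + 1) X := by
    cases m with
    | zero => simp [hypPoly]
    | succ m =>
      have := hypPoly_contiguous m ((m + 1 : ℕ) + (a + b)) (b + 1) X
      rw [Nat.add_sub_cancel]
      push_cast at this ⊢
      linear_combination this
  have g1 := (poch_pos_of_one_lt hab m m).ne'
  have g2 := Nat.factorial_ne_zero m
  have g3 : 2 * (m : ℝ) + (a + b) ≠ 0 := by positivity
  have g5 : (m : ℝ) + (a + b) + m = 2 * m + (a + b) := by ring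
  rw [poch_succ, g5]
  generalize hypPoly m (m + (a + b) + 1) (b + 1) X = A at *
  generalize hypPoly (m - 1) (m + (a + b)) (b + 1) X = B at *
  generalize hypPoly m (m + (a + b)) (b + 1) X = C at *
  have hC : C = ((m + (a + b)) * A + m * B) / (2 * m + (a + b)) := by
    rw [eq_div_iff g3]; linear_combination -hc
  rw [hC]
  field_simp
  ring

lemma evenCoeff_add_oddCoeff (hb : 0 < b) (hab : 1 < a + b) (m : ℕ) :
    (m + a) / (2 * m + (a + b)) * evenCoeff a b s X r m + (m + b) * oddCoeff a b s X r m =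
      (1 - r) * (s ^ m * productCoeff (a + 1) b X m) := by
  simp only [evenCoeff, oddCoeff, productCoeff, evenJacobi, oddJacobi]
  rw [show (m : ℝ) + (a + 1 + b) - 1 = m + (a + b) by ring]
  have hc : (m + b) * (m + (a + b)) * hypPoly m (m + (a + b) + 1) (b + 1) X -
      m * (m + a) * hypPoly (m - 1) (m + (a + b)) (b + 1) X =
      b * (2 * m + (a + b)) * hypPoly m (m + (a + b)) b X := by
    cases m with
    | zero => simp [hypPoly]
    | succ m =>
      have := hypPoly_contiguous_lower m ((m + 1 : ℕ) + (a + b)) X hb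
      rw [Nat.add_sub_cancel]
      push_cast at this ⊢
      linear_combination this
  have g1 := (poch_pos_of_one_lt hab m m).ne'
  have g2 := Nat.factorial_ne_zero m
  have g3 : 2 * (m : ℝ) + (a + b) ≠ 0 := by positivity
  have g5 : (m : ℝ) + (a + b) + m = 2 * m + (a + b) := by ring
  rw [poch_succ, g5]
  generalize hypPoly m (m + (a + b) + 1) (b + 1) X = A at *
  generalize hypPoly (m - 1) (m + (a + b)) (b + 1) X = B at *
  generalize hypPoly m (m + (a + b)) b X = C at *
  have hC : C = ((m + b) * (m + (a + b)) * A - m * (m + a) * B) / (b * (2 * m + (a + b))) := by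
    rw [eq_div_iff (mul_ne_zero hb.ne' g3)]; linear_combination -hc
  rw [hC]
  field_simp
  ring

end Combination

/-! ### Summation over both parities -/

/-- The interlacing of the four product formulas with parameters `(a, b)`, `(a + 1, b + 1)`,
`(a, b + 1)`, `(a + 1, b)`. Only the terms of even index need to be estimated: each odd term is a
difference of a term of a product formula and an even term. The constants `u`, `v`, `w` are the
weights of the parts odd in both variables, odd in the second, and odd in the first. -/
lemma hasSum_of_even_odd {a b : ℝ} (ha : 0 < a) (hb : 0 < b) (hab : 1 < a + b) {s : ℝ}
    (hs : s ≠ 0) (q r : ℝ) (x y u v w : ℂ) (f : ℕ → ℂ)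
    (hE : ∀ m : ℕ, f (2 * m) = (evenCoeff a b s (q / s) r m : ℂ) *
      (harmPoly a b m x y * hyp01 (a + b + 2 * m) ((x + y) * s) +
        u * (m * harmPoly (a + 1) (b + 1) (m - 1) x y) * hyp01 (a + b + 2 * m) ((x + y) * s) +
        v * (1 / (2 * m + (a + b)) : ℝ) * harmPoly a (b + 1) m x y *
          hyp01 (a + (b + 1) + 2 * m) ((x + y) * s) +
        w * ((m + a) / (2 * m + (a + b)) : ℝ) * harmPoly (a + 1) b m x y *
          hyp01 (a + 1 + b + 2 * m) ((x + y) * s)))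
    (hO : ∀ m : ℕ, f (2 * m + 1) = (oddCoeff a b s (q / s) r m : ℂ) *
      (-(s / (2 * m + 1 + (a + b)) : ℝ) * harmPoly a b (m + 1) x y *
          hyp01 (a + b + 2 * (m + 1 : ℕ)) ((x + y) * s) +
        u * (s * (m + (a + b)) / (2 * m + 1 + (a + b)) : ℝ) * harmPoly (a + 1) (b + 1) m x y *
          hyp01 (a + 1 + (b + 1) + 2 * m) ((x + y) * s) -
        v * harmPoly a (b + 1) m x y * hyp01 (a + (b + 1) + 2 * m) ((x + y) * s) +
        w * (m + b : ℝ) * harmPoly (a + 1) b m x y *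
          hyp01 (a + 1 + b + 2 * m) ((x + y) * s))) :
    HasSum f (hyp01 a (x * (s - q)) * hyp01 b (y * q) +
      u * (s * (q / s - r) / b : ℝ) * (hyp01 (a + 1) (x * (s - q)) * hyp01 (b + 1) (y * q)) +
      v * (r / b : ℝ) * (hyp01 a (x * (s - q)) * hyp01 (b + 1) (y * q)) +
      w * (1 - r : ℝ) * (hyp01 (a + 1) (x * (s - q)) * hyp01 b (y * q))) := by
  have hD := factorialDecay_evenCoeff hb hab s (q / s) r
  have hm : ∀ m : ℕ, (0 : ℝ) < 2 * m + (a + b) := fun m => by positivity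
  have hm1 : ∀ m : ℕ, (1 : ℝ) ≤ 2 * m + (a + b) := fun m => by
    have : (0 : ℝ) ≤ m := m.cast_nonneg
    linarith
  -- The product formulas.
  have F₁ := hasSum_product_formula ha hb hab hs q x y
  have F₂ := hasSum_product_formula (a := a + 1) (b := b + 1) (by positivity) (by positivity)
    (by linarith) hs q x y
  have F₃ := hasSum_product_formula (b := b + 1) ha (by positivity) (by linarith) hs q x y
  have F₄ := hasSum_product_formula (a := a + 1) (by positivity) hb (by linarith) hs q x y
  -- The four parts of the even terms.
  obtain ⟨S₁, E₁⟩ := hD.summable ha hb hab.le x y ((x + y) * s)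
  obtain ⟨S₂, E₂⟩ := hD.shift.summable (a := a + 1) (b := b + 1) (by positivity) (by positivity)
    (t := a + 1 + (b + 1)) (by linarith) x y ((x + y) * s)
  obtain ⟨S₃, E₃⟩ := (hD.of_abs_le (e := fun m => 1 / (2 * m + (a + b)) *
    evenCoeff a b s (q / s) r m) 1 fun m => by
      rw [abs_mul, abs_of_pos (one_div_pos.2 (hm m)), one_mul]
      gcongr
      exact (div_le_one (hm m)).2 (hm1 m) |>.trans (by simp)).summable (b := b + 1) ha
    (by positivity) (t := a + (b + 1)) (by linarith) x y ((x + y) * s)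
  obtain ⟨S₄, E₄⟩ := (hD.of_abs_le (e := fun m => (m + a) / (2 * m + (a + b)) *
    evenCoeff a b s (q / s) r m) 1 fun m => by
      rw [abs_mul, abs_of_pos (div_pos (by positivity) (hm m)), one_mul]
      gcongr
      refine ((div_le_one (hm m)).2 ?_).trans (by simp)
      have : (0 : ℝ) ≤ m := m.cast_nonneg
      linarith).summable (a := a + 1) (by positivity) hb
    (t := a + 1 + b) (by linarith) x y ((x + y) * s)
  -- The parts of the odd terms, by subtraction. The first is shifted by one: the summand of `F₁`
  -- with index `0` comes from the even terms alone.
  have O₁ := ((hasSum_nat_add_iff' 1).2 F₁).sub ((hasSum_nat_add_iff' 1).2 E₁)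
  have O₂ := (F₂.mul_left ((s * (q / s - r) / b : ℝ) : ℂ)).sub E₂
  have O₃ := (F₃.mul_left ((r / b : ℝ) : ℂ)).sub E₃
  have O₄ := (F₄.mul_left ((1 - r : ℝ) : ℂ)).sub E₄
  have E₂' : HasSum (fun m : ℕ => (evenCoeff a b s (q / s) r m : ℂ) *
      (m * harmPoly (a + 1) (b + 1) (m - 1) x y) * hyp01 (a + b + 2 * m) ((x + y) * s)) S₂ := by
    refine (hasSum_nat_add_iff' 1).1 ?_
    simp only [sum_range_one, Nat.cast_zero, zero_mul, mul_zero, sub_zero]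
    refine HasSum.congr_fun E₂ fun m => ?_
    rw [Nat.add_sub_cancel, show a + b + 2 * ((m + 1 : ℕ) : ℝ) = a + 1 + (b + 1) + 2 * m by
      push_cast; ring]
    push_cast
    ring
  have hE' : HasSum (fun m => f (2 * m)) (S₁ + u * S₂ + v * S₃ + w * S₄) := by
    refine HasSum.congr_fun
      (((E₁.add (E₂'.mul_left u)).add (E₃.mul_left v)).add (E₄.mul_left w)) fun m => ?_
    rw [hE]
    push_cast
    ring
  have hO₀ := ((O₁.add (O₂.mul_left u)).add (O₃.mul_left v)).add (O₄.mul_left w)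
  have hO' := hO₀.congr_fun (g := fun m => f (2 * m + 1)) fun m => by
    rw [hO]
    have c₁ := congrArg (fun t : ℝ => (t : ℂ)) (evenCoeff_succ_sub_oddCoeff s (q / s) r hab m)
    have c₂ := congrArg (fun t : ℝ => (t : ℂ))
      (evenCoeff_succ_add_oddCoeff s (q / s) r hb hab m)
    have c₃ := congrArg (fun t : ℝ => (t : ℂ)) (evenCoeff_sub_oddCoeff s (q / s) r hb hab m)
    have c₄ := congrArg (fun t : ℝ => (t : ℂ)) (evenCoeff_add_oddCoeff s (q / s) r hb hab m)
    push_cast at c₁ c₂ c₃ c₄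
    push_cast
    linear_combination
        (harmPoly a b (m + 1) x y * hyp01 (a + b + 2 * (m + 1)) ((x + y) * s)) * c₁ +
        (u * harmPoly (a + 1) (b + 1) m x y * hyp01 (a + 1 + (b + 1) + 2 * m) ((x + y) * s)) * c₂ +
        (v * harmPoly a (b + 1) m x y * hyp01 (a + (b + 1) + 2 * m) ((x + y) * s)) * c₃ +
        (w * harmPoly (a + 1) b m x y * hyp01 (a + 1 + b + 2 * m) ((x + y) * s)) * c₄
  have h := hE'.even_add_odd hO'
  simp only [sum_range_one, evenCoeff_zero, pow_zero, one_mul] at h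
  convert h using 1
  ring

/-! ### Evaluation of the constants and coefficients -/

lemma muFact_two_mul (m : ℕ) (μ : ℝ) :
    muFact (2 * m) μ = 4 ^ m * m.factorial * poch (μ + 1 / 2) m := by
  induction m with
  | zero => simp [muFact]
  | succ m ih =>
    have h : muFact (2 * (m + 1)) μ =
        muFact (2 * m) μ * muNum (2 * m + 1) μ * muNum (2 * m + 1 + 1) μ := by
      rw [show 2 * (m + 1) = 2 * m + 1 + 1 by ring]
      simp [muFact, prod_range_succ]
    have h1 : (-1 : ℝ) ^ (2 * m + 1) = -1 := by rw [pow_succ, pow_mul]; simp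
    have h2 : (-1 : ℝ) ^ (2 * m + 1 + 1) = 1 := by rw [pow_succ, h1]; norm_num
    rw [h, ih, muNum, muNum, h1, h2, poch_succ, Nat.factorial_succ, pow_succ]
    push_cast
    ring

lemma muFact_two_mul_add_one (m : ℕ) (μ : ℝ) :
    muFact (2 * m + 1) μ = 2 * 4 ^ m * m.factorial * poch (μ + 1 / 2) (m + 1) := by
  have h : muFact (2 * m + 1) μ = muFact (2 * m) μ * muNum (2 * m + 1) μ := by
    simp [muFact, prod_range_succ]
  have h1 : (-1 : ℝ) ^ (2 * m + 1) = -1 := by rw [pow_succ, pow_mul]; simp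
  rw [h, muFact_two_mul, muNum, h1, poch_succ]
  push_cast
  ring

/-- The ratio of Gamma factors in the normalization constant, for even index. -/
lemma gamma_ratio_even {μ₁ μ₂ : ℝ} (h₁ : 0 < μ₁) (h₂ : 0 < μ₂) (m : ℕ) :
    Real.Gamma (μ₁ + 1 / 2) * Real.Gamma (μ₂ + 1 / 2) /
        (Real.Gamma (mu12 μ₁ μ₂ (2 * m) + 1 / 2) * jacobiNorm (2 * m) (2 * μ₂) (2 * μ₁)) =
      poch (μ₂ + 1 / 2) m / (poch (μ₁ + 1 / 2) m * m.factorial *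
        poch (m + (μ₁ + 1 / 2 + (μ₂ + 1 / 2))) m) := by
  have hx : 0 < (m : ℝ) + (μ₁ + 1 / 2 + (μ₂ + 1 / 2)) := by positivity
  have hy : 0 < μ₂ + 1 / 2 + (m : ℝ) := by positivity
  rw [jacobiNorm, if_pos (even_two_mul m), Nat.mul_div_cancel_left _ two_pos, mu12]
  push_cast
  rw [show μ₁ + μ₂ + 1 / 2 + 2 * (m : ℝ) + 1 / 2 = m + (μ₁ + 1 / 2 + (μ₂ + 1 / 2)) + m by ring,
    show (2 * (m : ℝ) + 2 * μ₁ + 1) / 2 = μ₁ + 1 / 2 + m by ring,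
    show (2 * (m : ℝ) + 2 * μ₂ + 3) / 2 = μ₂ + 1 / 2 + m + 1 by ring,
    show (2 * (m : ℝ) + 2 * μ₂ + 2 * μ₁ + 2) / 2 = m + (μ₁ + 1 / 2 + (μ₂ + 1 / 2)) by ring,
    show (2 * μ₂ + 1) / 2 = μ₂ + 1 / 2 by ring, Real.Gamma_add_one hy.ne',
    Gamma_add_natCast hx, Gamma_add_natCast (by positivity), Gamma_add_natCast (by positivity)]
  have g1 := (Real.Gamma_pos_of_pos hx).ne'
  have g2 := (Real.Gamma_pos_of_pos (show 0 < μ₁ + 1 / 2 by positivity)).ne'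
  have g3 := (Real.Gamma_pos_of_pos (show 0 < μ₂ + 1 / 2 by positivity)).ne'
  have g4 := poch_ne_zero (show 0 < μ₁ + 1 / 2 by positivity) m
  have g5 := poch_ne_zero (show 0 < μ₂ + 1 / 2 by positivity) m
  have g6 := poch_ne_zero hx m
  have g7 := Nat.factorial_ne_zero m
  have g8 : 2 * (m : ℝ) + 2 * μ₂ + 1 = 2 * (μ₂ + 1 / 2 + m) := by ring
  rw [g8]
  generalize μ₂ + 1 / 2 + (m : ℝ) = y at *
  generalize (m : ℝ) + (μ₁ + 1 / 2 + (μ₂ + 1 / 2)) = x at *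
  generalize μ₁ + 1 / 2 = a at *
  generalize μ₂ + 1 / 2 = b at *
  have := hy.ne'
  field_simp

/-- The ratio of Gamma factors in the normalization constant, for odd index. -/
lemma gamma_ratio_odd {μ₁ μ₂ : ℝ} (h₁ : 0 < μ₁) (h₂ : 0 < μ₂) (m : ℕ) :
    Real.Gamma (μ₁ + 1 / 2) * Real.Gamma (μ₂ + 1 / 2) /
        (Real.Gamma (mu12 μ₁ μ₂ (2 * m + 1) + 1 / 2) *
          jacobiNorm (2 * m + 1) (2 * μ₂) (2 * μ₁)) =
      poch (μ₂ + 1 / 2) (m + 1) / (poch (μ₁ + 1 / 2) (m + 1) * m.factorial *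
        poch (m + (μ₁ + 1 / 2 + (μ₂ + 1 / 2))) (m + 1)) := by
  have hx : 0 < (m : ℝ) + (μ₁ + 1 / 2 + (μ₂ + 1 / 2)) := by positivity
  rw [jacobiNorm, if_neg (by simp), Nat.add_sub_cancel,
    Nat.mul_div_cancel_left _ two_pos, show (2 * m + 1 + 1) / 2 = m + 1 by omega, mu12]
  push_cast
  rw [show μ₁ + μ₂ + 1 / 2 + (2 * (m : ℝ) + 1) + 1 / 2 =
      m + (μ₁ + 1 / 2 + (μ₂ + 1 / 2)) + (m + 1 : ℕ) by push_cast; ring,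
    show (2 * (m : ℝ) + 1 + 2 * μ₁ + 2) / 2 = μ₁ + 1 / 2 + (m + 1 : ℕ) by push_cast; ring,
    show (2 * (m : ℝ) + 1 + 2 * μ₂ + 2) / 2 = μ₂ + 1 / 2 + (m + 1 : ℕ) by push_cast; ring,
    show (2 * (m : ℝ) + 1 + 2 * μ₂ + 2 * μ₁ + 3) / 2 =
      m + (μ₁ + 1 / 2 + (μ₂ + 1 / 2)) + 1 by ring,
    show (2 * μ₂ + 1) / 2 = μ₂ + 1 / 2 by ring, Real.Gamma_add_one hx.ne',
    Gamma_add_natCast hx, Gamma_add_natCast (by positivity), Gamma_add_natCast (by positivity),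
    show 2 * (m : ℝ) + 1 + 2 * μ₂ + 2 * μ₁ + 1 = 2 * (m + (μ₁ + 1 / 2 + (μ₂ + 1 / 2))) by ring]
  have g1 := (Real.Gamma_pos_of_pos hx).ne'
  have g2 := (Real.Gamma_pos_of_pos (show 0 < μ₁ + 1 / 2 by positivity)).ne'
  have g3 := (Real.Gamma_pos_of_pos (show 0 < μ₂ + 1 / 2 by positivity)).ne'
  have g4 := poch_ne_zero (show 0 < μ₁ + 1 / 2 by positivity) (m + 1)
  have g5 := poch_ne_zero (show 0 < μ₂ + 1 / 2 by positivity) (m + 1)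
  have g6 := poch_ne_zero hx (m + 1)
  have g7 := Nat.factorial_ne_zero m
  generalize (m : ℝ) + (μ₁ + 1 / 2 + (μ₂ + 1 / 2)) = x at *
  generalize μ₁ + 1 / 2 = a at *
  generalize μ₂ + 1 / 2 = b at *
  have := hx.ne'
  field_simp

section Sign

variable {ε₁ ε₂ : ℝ}

lemma mul_self_eq_one_of_sign (h : ε₁ = 1 ∨ ε₁ = -1) : ε₁ * ε₁ = 1 := by
  rcases h with rfl | rfl <;> norm_num

lemma abs_mul_signs (h₁ : ε₁ = 1 ∨ ε₁ = -1) (h₂ : ε₂ = 1 ∨ ε₂ = -1) (c : ℝ) :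
    |c * ε₁ * ε₂| = |c| := by
  rcases h₁ with rfl | rfl <;> rcases h₂ with rfl | rfl <;> simp

end Sign

/-- For even index the normalization constants multiply to a rational expression. -/
lemma normK_mul_prefactor_even {μ₁ μ₂ ε₁ ε₂ c l : ℝ} (h₁ : 0 < μ₁) (h₂ : 0 < μ₂)
    (hε₁ : ε₁ = 1 ∨ ε₁ = -1) (hε₂ : ε₂ = 1 ∨ ε₂ = -1) (hl : |c| < |l|) (m : ℕ) :
    normK (2 * m) l μ₂ μ₁ c ε₁ ε₂ * prefactor (2 * m) μ₁ μ₂ =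
      (-1) ^ m * ((l ^ 2 - c ^ 2) / 4) ^ m /
        (m.factorial * poch (m + (μ₁ + 1 / 2 + (μ₂ + 1 / 2))) m) := by
  have hs : 0 < l ^ 2 - c ^ 2 := sub_pos.2 (sq_lt_sq.2 hl)
  have hl0 : l ≠ 0 := abs_pos.1 ((abs_nonneg c).trans_lt hl)
  have hx : 0 < (m : ℝ) + (μ₁ + 1 / 2 + (μ₂ + 1 / 2)) := by positivity
  have hC : l - c * ε₁ * ε₂ ≠ 0 := fun h => by
    rw [← abs_mul_signs hε₁ hε₂ c, ← sub_eq_zero.1 h] at hl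
    exact lt_irrefl _ hl
  have hsign : Real.sign l ^ (2 * m) = 1 := by
    rcases Real.sign_apply_eq_of_ne_zero l hl0 with h | h <;> simp [h, pow_mul]
  have hone : (-1 : ℝ) ^ (2 * m) = 1 := by simp [pow_mul]
  have p1 := poch_pos (show 0 < μ₁ + 1 / 2 by positivity) m
  have p2 := poch_pos (show 0 < μ₂ + 1 / 2 by positivity) m
  have p3 := poch_pos hx m
  have p4 : (0 : ℝ) < m.factorial := by positivity
  rw [normK, prefactor, hsign, one_mul, hone, gamma_ratio_even h₁ h₂, muFact_two_mul,
    show 2 * m / 2 + 2 * m % 2 = m by omega, show 2 * m / 2 = m by omega,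
    show (m : ℝ) + 1 + μ₁ + μ₂ = m + (μ₁ + 1 / 2 + (μ₂ + 1 / 2)) by ring, one_mul, div_self hC,
    mul_one, add_comm (1 / 2) μ₁]
  generalize poch (m + (μ₁ + 1 / 2 + (μ₂ + 1 / 2))) m = P at *
  generalize poch (μ₁ + 1 / 2) m = A at *
  generalize poch (μ₂ + 1 / 2) m = B at *
  generalize (m.factorial : ℝ) = F at *
  generalize l ^ 2 - c ^ 2 = S at *
  have key : √((S / 2) ^ (2 * m) * (B / (A * F * P))) / √(4 ^ m * F * B) * √(A / P) =
      (S / 4) ^ m / (F * P) := by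
    rw [← Real.sqrt_div' _ (by positivity), ← Real.sqrt_mul' _ (by positivity),
      show (S / 2) ^ (2 * m) * (B / (A * F * P)) / (4 ^ m * F * B) * (A / P) =
        ((S / 4) ^ m / (F * P)) ^ 2 by
        rw [pow_mul, show (S / 2) ^ 2 = S / 4 * (S / 4) * 4 by ring, mul_pow, mul_pow]
        field_simp, Real.sqrt_sq (by positivity)]
  rw [mul_div_assoc, ← key]
  ring

/-- For odd index the square roots leave `|λ₂ - c ε₁ ε₂|`, and the sign of `λ₂` turns it into
`λ₂ - c ε₁ ε₂`. -/
lemma normK_mul_prefactor_odd {μ₁ μ₂ ε₁ ε₂ c l : ℝ} (h₁ : 0 < μ₁) (h₂ : 0 < μ₂)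
    (hε₁ : ε₁ = 1 ∨ ε₁ = -1) (hε₂ : ε₂ = 1 ∨ ε₂ = -1) (hl : |c| < |l|) (m : ℕ) :
    normK (2 * m + 1) l μ₂ μ₁ c ε₁ ε₂ * prefactor (2 * m + 1) μ₁ μ₂ =
      -((l - c * ε₁ * ε₂) / 2) * ((-1) ^ m * ((l ^ 2 - c ^ 2) / 4) ^ m /
        (m.factorial * poch (m + (μ₁ + 1 / 2 + (μ₂ + 1 / 2))) (m + 1))) := by
  have hs : 0 < l ^ 2 - c ^ 2 := sub_pos.2 (sq_lt_sq.2 hl)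
  have hx : 0 < (m : ℝ) + (μ₁ + 1 / 2 + (μ₂ + 1 / 2)) := by positivity
  have hcC : l ^ 2 - c ^ 2 = (l - c * ε₁ * ε₂) * (l + c * ε₁ * ε₂) := by
    linear_combination (c ^ 2 * (ε₂ * ε₂)) * mul_self_eq_one_of_sign hε₁ +
      c ^ 2 * mul_self_eq_one_of_sign hε₂
  have hC : |c * ε₁ * ε₂| < |l| := by rwa [abs_mul_signs hε₁ hε₂]
  have hone : (-1 : ℝ) ^ (2 * m + 1) = -1 := by simp [pow_succ, pow_mul]
  have p1 := poch_pos (show 0 < μ₁ + 1 / 2 by positivity) (m + 1)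
  have p2 := poch_pos (show 0 < μ₂ + 1 / 2 by positivity) (m + 1)
  have p3 := poch_pos hx (m + 1)
  have p4 : (0 : ℝ) < m.factorial := by positivity
  have hsign : Real.sign l ^ (2 * m + 1) * |l - c * ε₁ * ε₂| = l - c * ε₁ * ε₂ := by
    rcases lt_trichotomy l 0 with h | h | h
    · rw [abs_of_neg h] at hC
      rw [Real.sign_of_neg h, hone, abs_of_neg (by linarith [(abs_lt.1 hC).1])]
      ring
    · rw [h, abs_zero] at hC
      exact absurd (abs_nonneg _) (not_le.2 hC)
    · rw [abs_of_pos h] at hC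
      rw [Real.sign_of_pos h, one_pow, abs_of_pos (by linarith [(abs_lt.1 hC).2])]
      ring
  rw [normK, prefactor, gamma_ratio_odd h₁ h₂, muFact_two_mul_add_one, hone,
    show (2 * m + 1) / 2 + (2 * m + 1) % 2 = m + 1 by omega, show (2 * m + 1) / 2 = m by omega,
    show (m : ℝ) + 1 + μ₁ + μ₂ = m + (μ₁ + 1 / 2 + (μ₂ + 1 / 2)) by ring,
    show l - -1 * c * ε₁ * ε₂ = l + c * ε₁ * ε₂ by ring, add_comm (1 / 2) μ₁]
  generalize poch (m + (μ₁ + 1 / 2 + (μ₂ + 1 / 2))) (m + 1) = P at *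
  generalize poch (μ₁ + 1 / 2) (m + 1) = A at *
  generalize poch (μ₂ + 1 / 2) (m + 1) = B at *
  generalize (m.factorial : ℝ) = F at *
  generalize l ^ 2 - c ^ 2 = S at *
  generalize l - c * ε₁ * ε₂ = u at *
  generalize l + c * ε₁ * ε₂ = v at *
  have hv : v ≠ 0 := fun h => by rw [h, mul_zero] at hcC; exact hs.ne' hcC
  have key : √((S / 2) ^ (2 * m + 1) * (u / v) * (B / (A * F * P))) / √(2 * 4 ^ m * F * B) *
      √(A / P) = |u| / 2 * ((S / 4) ^ m / (F * P)) := by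
    rw [← Real.sqrt_div' _ (by positivity), ← Real.sqrt_mul' _ (by positivity),
      show (S / 2) ^ (2 * m + 1) * (u / v) * (B / (A * F * P)) / (2 * 4 ^ m * F * B) * (A / P) =
        (|u| / 2 * ((S / 4) ^ m / (F * P))) ^ 2 by
        rw [pow_succ, pow_mul, show (S / 2) ^ 2 = S / 4 * (S / 4) * 4 by ring, mul_pow, mul_pow,
          mul_pow, div_pow |u|, sq_abs, show S / 2 = u * v / 2 by rw [hcC]]
        field_simp, Real.sqrt_sq (by positivity)]
  calc _ = (-1) ^ (m + 1) * (Real.sign l ^ (2 * m + 1) *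
        (√((S / 2) ^ (2 * m + 1) * (u / v) * (B / (A * F * P))) / √(2 * 4 ^ m * F * B) *
          √(A / P))) := by ring
    _ = (-1) ^ (m + 1) * ((Real.sign l ^ (2 * m + 1) * |u|) / 2 * ((S / 4) ^ m / (F * P))) := by
      rw [key]; ring
    _ = _ := by rw [hsign]; ring

lemma bigJacobi_even (m : ℕ) (x a b c : ℝ) :
    bigJacobi (2 * m) x (2 * b) (2 * a) c =
      evenJacobi (a + 1 / 2) (b + 1 / 2) ((1 - x ^ 2) / (1 - c ^ 2)) ((1 - x) / (1 + c)) m := by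
  rw [bigJacobi, if_pos (even_two_mul m), evenJacobi]
  push_cast
  rw [show -(2 * (m : ℝ)) / 2 = -m by ring,
    show (2 * (m : ℝ) + 2 * b + 2 * a + 2) / 2 = m + (a + 1 / 2 + (b + 1 / 2)) by ring,
    show (2 * b + 1) / 2 = b + 1 / 2 by ring, show (2 * b + 3) / 2 = b + 1 / 2 + 1 by ring,
    ordinaryHypergeometric_eq_hypPoly, show 2 * b + 1 = 2 * (b + 1 / 2) by ring]
  cases m with
  | zero => simp
  | succ m =>
    rw [show 1 - 2 * ((m + 1 : ℕ) : ℝ) / 2 = -(m : ℝ) by push_cast; ring,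
      ordinaryHypergeometric_eq_hypPoly, Nat.add_sub_cancel]
    generalize b + 1 / 2 = B, 1 + c = C
    push_cast
    ring

lemma bigJacobi_odd (m : ℕ) (x a b c : ℝ) :
    bigJacobi (2 * m + 1) x (2 * b) (2 * a) c =
      oddJacobi (a + 1 / 2) (b + 1 / 2) ((1 - x ^ 2) / (1 - c ^ 2)) ((1 - x) / (1 + c)) m := by
  rw [bigJacobi, if_neg (by simp), oddJacobi]
  push_cast
  rw [show -(2 * (m : ℝ) + 1 - 1) / 2 = -m by ring,
    show (2 * (m : ℝ) + 1 + 2 * b + 2 * a + 1) / 2 = m + (a + 1 / 2 + (b + 1 / 2)) by ring,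
    show (2 * (m : ℝ) + 1 + 2 * b + 2 * a + 3) / 2 = m + (a + 1 / 2 + (b + 1 / 2)) + 1 by ring,
    show (2 * b + 1) / 2 = b + 1 / 2 by ring, show (2 * b + 3) / 2 = b + 1 / 2 + 1 by ring,
    ordinaryHypergeometric_eq_hypPoly, ordinaryHypergeometric_eq_hypPoly,
    show 2 * b + 1 = 2 * (b + 1 / 2) by ring,
    show 2 * (m : ℝ) + 1 + 2 * b + 2 * a + 1 = 2 * (m + (a + 1 / 2 + (b + 1 / 2))) by ring]
  generalize b + 1 / 2 = B, 1 + c = C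
  ring

/-- Homogenization of the terminating `₂F₁` series of the coefficients `fe` and `fo`. -/
lemma pow_mul_ordinaryHypergeometric (a : ℝ) {b : ℝ} (hb : 0 < b) (m : ℕ) (z₁ : ℂ) {z₂ : ℂ}
    (hz₂ : z₂ ≠ 0) :
    z₂ ^ (2 * m) * ordinaryHypergeometric (-(m : ℝ)) (1 - m - b) a (-(z₁ / z₂) ^ 2) =
      harmPoly a b m (z₁ ^ 2) (z₂ ^ 2) := by
  rw [ordinaryHypergeometric_neg_natCast, harmPoly, mul_sum,
    Nat.sum_antidiagonal_eq_sum_range_succ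
      (fun i j => (harm a b m i j : ℂ) * (z₁ ^ 2) ^ i * (z₂ ^ 2) ^ j)]
  refine sum_congr rfl fun i hi => ?_
  have hi' : i ≤ m := by simpa [Nat.lt_succ_iff] using hi
  obtain ⟨j, rfl⟩ := Nat.exists_eq_add_of_le hi'
  rw [Nat.add_sub_cancel_left, harm, if_pos rfl, Complex.real_smul]
  have hch : ((i + j).factorial : ℝ) = (i + j).choose i * i.factorial * j.factorial := by
    rw [Nat.choose_symm_add]
    exact_mod_cast (Nat.add_choose_mul_factorial_mul_factorial i j).symm
  have hr : poch (1 - ((i + j : ℕ) : ℝ) - b) i = (-1) ^ i * poch b (i + j) / poch b j := by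
    rw [eq_div_iff (poch_ne_zero hb j), poch_reverse]
  have hj := poch_ne_zero hb j
  have g1 := Nat.factorial_ne_zero i
  have g2 := Nat.factorial_ne_zero j
  have hcoef : (-1) ^ i * ((i + j).choose i : ℝ) * poch (1 - ((i + j : ℕ) : ℝ) - b) i / poch a i =
      (-1) ^ i * ((-1) ^ i * (i + j).factorial * poch b (i + j) /
        (i.factorial * j.factorial * poch a i * poch b j)) := by
    rw [hr, hch]
    field_simp
  rw [hcoef, neg_pow ((z₁ / z₂) ^ 2), ← pow_mul z₂, ← pow_mul, ← pow_mul, div_pow,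
    show 2 * (i + j) = 2 * i + 2 * j by ring, pow_add z₂, Complex.ofReal_mul]
  have hone : ((-1 : ℂ) ^ i) * (-1) ^ i = 1 := by rw [← mul_pow]; simp
  have hz : z₂ ^ (2 * i) ≠ 0 := pow_ne_zero _ hz₂
  generalize (((-1) ^ i * (i + j).factorial * poch b (i + j) /
        (i.factorial * j.factorial * poch a i * poch b j) : ℝ) : ℂ) = R
  push_cast
  field_simp
  linear_combination (R * z₁ ^ (2 * i)) * hone

section Coefficients

variable {μ₁ μ₂ ε₂ : ℝ} (z₁ : ℂ) {z₂ : ℂ}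

lemma fe_even (h₁ : 0 < μ₁) (h₂ : 0 < μ₂) (hε₂ : ε₂ ≠ 0) (hz₂ : z₂ ≠ 0) (m : ℕ) :
    fe (2 * m) μ₁ μ₂ ε₂ z₁ z₂ = (prefactor (2 * m) μ₁ μ₂ : ℂ) *
      (harmPoly (μ₁ + 1 / 2) (μ₂ + 1 / 2) m (z₁ ^ 2) (z₂ ^ 2) +
        z₁ * z₂ / ((ε₂ * (μ₁ + 1 / 2) : ℝ) : ℂ) *
          (m * harmPoly (μ₁ + 1 / 2 + 1) (μ₂ + 1 / 2 + 1) (m - 1) (z₁ ^ 2) (z₂ ^ 2))) := by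
  have hα : ε₂ * (μ₁ + 1 / 2) ≠ 0 := mul_ne_zero hε₂ (by positivity)
  have hα' : ((ε₂ * (μ₁ + 1 / 2) : ℝ) : ℂ) ≠ 0 := Complex.ofReal_ne_zero.2 hα
  simp only [fe, show 2 * m / 2 = m by omega, show 2 * m % 2 = 0 by omega, Nat.cast_zero, sub_zero,
    mul_zero, add_zero, pow_zero, one_mul]
  rw [← pow_mul_ordinaryHypergeometric (μ₁ + 1 / 2) (show 0 < μ₂ + 1 / 2 by positivity) m z₁ hz₂,
    show 1 / 2 - (m : ℝ) - μ₂ = 1 - m - (μ₂ + 1 / 2) by ring, add_comm (1 / 2) μ₁,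
    show ε₂ * (1 + 2 * μ₁) = 2 * (ε₂ * (μ₁ + 1 / 2)) by ring]
  cases m with
  | zero => simp
  | succ m =>
    rw [Nat.add_sub_cancel, ← pow_mul_ordinaryHypergeometric (μ₁ + 1 / 2 + 1)
        (show 0 < μ₂ + 1 / 2 + 1 by positivity) m z₁ hz₂,
      show 1 - ((m + 1 : ℕ) : ℝ) = -m by push_cast; ring,
      show -(m : ℝ) - (μ₂ + 1 / 2) = 1 - m - (μ₂ + 1 / 2 + 1) by ring,
      show 3 / 2 + μ₁ = μ₁ + 1 / 2 + 1 by ring]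
    generalize ordinaryHypergeometric (-(m : ℝ)) (1 - m - (μ₂ + 1 / 2 + 1)) (μ₁ + 1 / 2 + 1)
      (-(z₁ / z₂) ^ 2) = G
    generalize ordinaryHypergeometric (_ : ℝ) _ _ (-(z₁ / z₂) ^ 2) = F
    generalize ε₂ * (μ₁ + 1 / 2) = A at *
    push_cast
    field_simp
    ring

lemma fo_even (h₁ : 0 < μ₁) (h₂ : 0 < μ₂) (hε₂ : ε₂ ≠ 0) (hz₂ : z₂ ≠ 0) (w : ℂ) (m : ℕ) :
    fo (2 * m) μ₁ μ₂ ε₂ z₁ z₂ w = (prefactor (2 * m) μ₁ μ₂ : ℂ) / w *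
      (z₂ * harmPoly (μ₁ + 1 / 2) (μ₂ + 1 / 2 + 1) m (z₁ ^ 2) (z₂ ^ 2) +
        z₁ * ((m + (μ₁ + 1 / 2) : ℝ) : ℂ) / ((ε₂ * (μ₁ + 1 / 2) : ℝ) : ℂ) *
          harmPoly (μ₁ + 1 / 2 + 1) (μ₂ + 1 / 2) m (z₁ ^ 2) (z₂ ^ 2)) := by
  have hα : ε₂ * (μ₁ + 1 / 2) ≠ 0 := mul_ne_zero hε₂ (by positivity)
  have hα' : ((ε₂ * (μ₁ + 1 / 2) : ℝ) : ℂ) ≠ 0 := Complex.ofReal_ne_zero.2 hα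
  simp only [fo, show 2 * m / 2 = m by omega, show 2 * m % 2 = 0 by omega, Nat.cast_zero, sub_zero,
    mul_zero, add_zero, pow_zero, one_mul]
  rw [← pow_mul_ordinaryHypergeometric (μ₁ + 1 / 2) (show 0 < μ₂ + 1 / 2 + 1 by positivity) m z₁ hz₂,
    ← pow_mul_ordinaryHypergeometric (μ₁ + 1 / 2 + 1) (show 0 < μ₂ + 1 / 2 by positivity) m z₁ hz₂,
    show 1 / 2 - (m : ℝ) - μ₂ = 1 - m - (μ₂ + 1 / 2) by ring,
    show -1 / 2 - (m : ℝ) - μ₂ = 1 - m - (μ₂ + 1 / 2 + 1) by ring, add_comm (1 / 2) μ₁,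
    show 3 / 2 + μ₁ = μ₁ + 1 / 2 + 1 by ring,
    show ε₂ * (1 + 2 * μ₁) = 2 * (ε₂ * (μ₁ + 1 / 2)) by ring]
  generalize ordinaryHypergeometric (-(m : ℝ)) (1 - m - (μ₂ + 1 / 2 + 1)) (μ₁ + 1 / 2)
    (-(z₁ / z₂) ^ 2) = G
  generalize ordinaryHypergeometric (_ : ℝ) _ _ (-(z₁ / z₂) ^ 2) = F
  generalize ε₂ * (μ₁ + 1 / 2) = A at *
  push_cast
  field_simp
  ring

lemma fe_odd (h₁ : 0 < μ₁) (h₂ : 0 < μ₂) (hε₂ : ε₂ ≠ 0) (hz₂ : z₂ ≠ 0) (m : ℕ) :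
    fe (2 * m + 1) μ₁ μ₂ ε₂ z₁ z₂ = (prefactor (2 * m + 1) μ₁ μ₂ : ℂ) *
      (z₂ * harmPoly (μ₁ + 1 / 2) (μ₂ + 1 / 2 + 1) m (z₁ ^ 2) (z₂ ^ 2) -
        z₁ * ((m + (μ₂ + 1 / 2) : ℝ) : ℂ) / ((ε₂ * (μ₁ + 1 / 2) : ℝ) : ℂ) *
          harmPoly (μ₁ + 1 / 2 + 1) (μ₂ + 1 / 2) m (z₁ ^ 2) (z₂ ^ 2)) := by
  have hα : ε₂ * (μ₁ + 1 / 2) ≠ 0 := mul_ne_zero hε₂ (by positivity)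
  have hα' : ((ε₂ * (μ₁ + 1 / 2) : ℝ) : ℂ) ≠ 0 := Complex.ofReal_ne_zero.2 hα
  simp only [fe, show (2 * m + 1) / 2 = m by omega, show (2 * m + 1) % 2 = 1 by omega, Nat.cast_one,
    mul_one, pow_one]
  rw [← pow_mul_ordinaryHypergeometric (μ₁ + 1 / 2) (show 0 < μ₂ + 1 / 2 + 1 by positivity) m z₁ hz₂,
    ← pow_mul_ordinaryHypergeometric (μ₁ + 1 / 2 + 1) (show 0 < μ₂ + 1 / 2 by positivity) m z₁ hz₂,
    show 1 / 2 - (m : ℝ) - μ₂ = 1 - m - (μ₂ + 1 / 2) by ring,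
    show 1 / 2 - (m : ℝ) - 1 - μ₂ = 1 - m - (μ₂ + 1 / 2 + 1) by ring, add_comm (1 / 2) μ₁,
    show 3 / 2 + μ₁ = μ₁ + 1 / 2 + 1 by ring, show 1 - (m : ℝ) - 1 = -m by ring,
    show ε₂ * (1 + 2 * μ₁) = 2 * (ε₂ * (μ₁ + 1 / 2)) by ring]
  generalize ordinaryHypergeometric (-(m : ℝ)) (1 - m - (μ₂ + 1 / 2 + 1)) (μ₁ + 1 / 2)
    (-(z₁ / z₂) ^ 2) = G
  generalize ordinaryHypergeometric (_ : ℝ) _ _ (-(z₁ / z₂) ^ 2) = F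
  generalize ε₂ * (μ₁ + 1 / 2) = A at *
  push_cast
  field_simp
  ring

lemma fo_odd (h₁ : 0 < μ₁) (h₂ : 0 < μ₂) (hε₂ : ε₂ ≠ 0) (hz₂ : z₂ ≠ 0) (w : ℂ) (m : ℕ) :
    fo (2 * m + 1) μ₁ μ₂ ε₂ z₁ z₂ w = (prefactor (2 * m + 1) μ₁ μ₂ : ℂ) / w *
      (harmPoly (μ₁ + 1 / 2) (μ₂ + 1 / 2) (m + 1) (z₁ ^ 2) (z₂ ^ 2) -
        z₁ * z₂ * ((m + (μ₁ + 1 / 2 + (μ₂ + 1 / 2)) : ℝ) : ℂ) /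
          ((ε₂ * (μ₁ + 1 / 2) : ℝ) : ℂ) *
          harmPoly (μ₁ + 1 / 2 + 1) (μ₂ + 1 / 2 + 1) m (z₁ ^ 2) (z₂ ^ 2)) := by
  have hα : ε₂ * (μ₁ + 1 / 2) ≠ 0 := mul_ne_zero hε₂ (by positivity)
  have hα' : ((ε₂ * (μ₁ + 1 / 2) : ℝ) : ℂ) ≠ 0 := Complex.ofReal_ne_zero.2 hα
  simp only [fo, show (2 * m + 1) / 2 = m by omega, show (2 * m + 1) % 2 = 1 by omega, Nat.cast_one,
    mul_one, pow_one]
  rw [← pow_mul_ordinaryHypergeometric (μ₁ + 1 / 2) (show 0 < μ₂ + 1 / 2 by positivity) (m + 1) z₁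
      hz₂,
    ← pow_mul_ordinaryHypergeometric (μ₁ + 1 / 2 + 1) (show 0 < μ₂ + 1 / 2 + 1 by positivity) m z₁
      hz₂,
    show -(m : ℝ) - 1 = -((m + 1 : ℕ) : ℝ) by push_cast; ring,
    show -1 / 2 - (m : ℝ) - μ₂ = 1 - (m + 1 : ℕ) - (μ₂ + 1 / 2) by push_cast; ring,
    show 1 / 2 - (m : ℝ) - 1 - μ₂ = 1 - m - (μ₂ + 1 / 2 + 1) by ring, add_comm (1 / 2) μ₁,
    show 3 / 2 + μ₁ = μ₁ + 1 / 2 + 1 by ring,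
    show ε₂ * (1 + 2 * μ₁) = 2 * (ε₂ * (μ₁ + 1 / 2)) by ring]
  generalize ordinaryHypergeometric (-(m : ℝ)) (1 - m - (μ₂ + 1 / 2 + 1)) (μ₁ + 1 / 2 + 1)
    (-(z₁ / z₂) ^ 2) = G
  generalize ordinaryHypergeometric (_ : ℝ) _ _ (-(z₁ / z₂) ^ 2) = F
  generalize ε₂ * (μ₁ + 1 / 2) = A at *
  push_cast
  field_simp
  ring

end Coefficients

/-- Regrouping of a term of even index. -/
lemma even_term_regroup {K P R w : ℂ} (hKP : K * P = R) (hw : w ≠ 0)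
    (J η σ z₁ z₂ n M D Q₁ Q₂ Q₃ Q₄ h₀ h₁ : ℂ) :
    K * J * (P * (Q₁ + z₁ * z₂ / η * (n * Q₂)) * h₀ +
        P / w * (z₂ * Q₃ + z₁ * M / η * Q₄) * (w * D / (2 * σ)) * h₁) =
      R * J * (Q₁ * h₀ + z₁ * z₂ / η * (n * Q₂) * h₀ + D / 2 * z₂ * (1 / σ) * Q₃ * h₁ +
        D / 2 * z₁ / η * (M / σ) * Q₄ * h₁) := by
  rw [← hKP]
  linear_combination (K * J * P * (z₂ * Q₃ + z₁ * M / η * Q₄) * D / (2 * σ) * h₁) *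
    mul_inv_cancel₀ hw

/-- Regrouping of a term of odd index. -/
lemma odd_term_regroup {K P R w s D E : ℂ} (hKP : K * P = -D * R) (hw : w ≠ 0) (hs : s = D * E / 2)
    (J η τ z₁ z₂ N T Q₁ Q₂ Q₃ Q₄ h₁ h₂ : ℂ) :
    K * J * (P * (z₂ * Q₃ - z₁ * N / η * Q₄) * h₁ +
        P / w * (Q₁ - z₁ * z₂ * T / η * Q₂) * (w * E / (2 * τ)) * h₂) =
      R * J * (-(s / τ) * Q₁ * h₂ + z₁ * z₂ / η * (s * T / τ) * Q₂ * h₂ - D * z₂ * Q₃ * h₁ +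
        D * z₁ / η * N * Q₄ * h₁) := by
  rw [hs]
  linear_combination (K * J * P * (Q₁ - z₁ * z₂ * T / η * Q₂) * E / (2 * τ) * h₂) *
    mul_inv_cancel₀ hw + (J * ((z₂ * Q₃ - z₁ * N / η * Q₄) * h₁ +
      (Q₁ - z₁ * z₂ * T / η * Q₂) * (E / (2 * τ)) * h₂)) * hKP

end DunklOP

theorem proposition9 (μ₁ μ₂ ε₁ ε₂ c lam₁ lam₂ : ℝ) (hμ₁ : 0 < μ₁) (hμ₂ : 0 < μ₂)
    (hε₁ : ε₁ = 1 ∨ ε₁ = -1) (hε₂ : ε₂ = 1 ∨ ε₂ = -1) (hlam₂ : |c| < |lam₂|)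
    (z₁ z₂ w : ℂ) (hz₂ : z₂ ≠ 0) (hw : w ^ 2 = z₁ ^ 2 + z₂ ^ 2) (hw0 : w ≠ 0) :
    HasSum
      (fun j : ℕ =>
        (DunklOP.normK j lam₂ μ₂ μ₁ c ε₁ ε₂ : ℂ) *
          (DunklOP.bigJacobi j (ε₂ * lam₁ / lam₂) (2 * μ₂) (2 * μ₁) (-(c * ε₁ * ε₂) / lam₂) : ℂ) *
          (DunklOP.fe j μ₁ μ₂ ε₂ z₁ z₂ *
              DunklOP.hyp01 (DunklOP.mu12 μ₁ μ₂ j + 1 / 2)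
                ((z₁ ^ 2 + z₂ ^ 2) * ((lam₂ : ℂ) ^ 2 - (c : ℂ) ^ 2) / 4)
            + DunklOP.fo j μ₁ μ₂ ε₂ z₁ z₂ w *
              (w * ((lam₂ - c * DunklOP.eps12 ε₁ ε₂ j : ℝ) : ℂ) /
                ((2 * DunklOP.mu12 μ₁ μ₂ j + 1 : ℝ) : ℂ)) *
              DunklOP.hyp01 (DunklOP.mu12 μ₁ μ₂ j + 3 / 2)
                ((z₁ ^ 2 + z₂ ^ 2) * ((lam₂ : ℂ) ^ 2 - (c : ℂ) ^ 2) / 4)))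
      ((DunklOP.hyp01 (μ₁ + 1 / 2) (z₁ ^ 2 * ((lam₁ : ℂ) ^ 2 - (c : ℂ) ^ 2) / 4)
          + z₁ * ((lam₁ - c * ε₁ : ℝ) : ℂ) / ((2 * μ₁ + 1 : ℝ) : ℂ) *
            DunklOP.hyp01 (μ₁ + 3 / 2) (z₁ ^ 2 * ((lam₁ : ℂ) ^ 2 - (c : ℂ) ^ 2) / 4)) *
        (DunklOP.hyp01 (μ₂ + 1 / 2) (z₂ ^ 2 * ((lam₂ : ℂ) ^ 2 - (lam₁ : ℂ) ^ 2) / 4)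
          + z₂ * ((lam₂ - lam₁ * ε₂ : ℝ) : ℂ) / ((2 * μ₂ + 1 : ℝ) : ℂ) *
            DunklOP.hyp01 (μ₂ + 3 / 2) (z₂ ^ 2 * ((lam₂ : ℂ) ^ 2 - (lam₁ : ℂ) ^ 2) / 4))) := by
  have hl0 : lam₂ ≠ 0 := abs_pos.1 ((abs_nonneg c).trans_lt hlam₂)
  have hS : 0 < lam₂ ^ 2 - c ^ 2 := sub_pos.2 (sq_lt_sq.2 hlam₂)
  have h11 := DunklOP.mul_self_eq_one_of_sign hε₁
  have h22 := DunklOP.mul_self_eq_one_of_sign hε₂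
  have hε₂0 : ε₂ ≠ 0 := fun h => by simp [h] at h22
  -- Opaque names keep the many real expressions below from being unfolded.
  obtain ⟨C, hC⟩ : ∃ t, t = c * ε₁ * ε₂ := ⟨_, rfl⟩
  have hcC : c ^ 2 = C ^ 2 := by
    rw [hC]
    linear_combination (-(c ^ 2 * (ε₂ * ε₂))) * h11 - c ^ 2 * h22
  have hprod : lam₂ ^ 2 - c ^ 2 = (lam₂ - C) * (lam₂ + C) := by rw [hcC]; ring
  have hCm : lam₂ - C ≠ 0 := fun h => by rw [h, zero_mul] at hprod; exact hS.ne' hprod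
  have hCp : lam₂ + C ≠ 0 := fun h => by rw [h, mul_zero] at hprod; exact hS.ne' hprod
  obtain ⟨s, hs⟩ : ∃ t, t = (lam₂ ^ 2 - c ^ 2) / 4 := ⟨_, rfl⟩
  obtain ⟨q, hq⟩ : ∃ t, t = (lam₂ ^ 2 - lam₁ ^ 2) / 4 := ⟨_, rfl⟩
  obtain ⟨a, ha⟩ : ∃ t, t = μ₁ + 1 / 2 := ⟨_, rfl⟩
  obtain ⟨b, hb⟩ : ∃ t, t = μ₂ + 1 / 2 := ⟨_, rfl⟩
  have ha0 : 0 < a := by rw [ha]; positivity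
  have hb0 : 0 < b := by rw [hb]; positivity
  have hs0 : s ≠ 0 := by rw [hs]; positivity
  have hsC : s = (lam₂ - C) * (lam₂ + C) / 4 := by rw [hs, hprod]
  obtain ⟨r, hr⟩ : ∃ t, t = (lam₂ - ε₂ * lam₁) / (lam₂ - C) := ⟨_, rfl⟩
  have hX : (1 - (ε₂ * lam₁ / lam₂) ^ 2) / (1 - (-C / lam₂) ^ 2) = q / s := by
    have : 1 - (-C / lam₂) ^ 2 = 4 * s / lam₂ ^ 2 := by rw [hsC]; field_simp; ring
    rw [this, div_pow, mul_pow, pow_two ε₂, h22, hq]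
    field_simp
  have hr' : (1 - ε₂ * lam₁ / lam₂) / (1 + -C / lam₂) = r := by
    have : 1 + -C / lam₂ = (lam₂ - C) / lam₂ := by field_simp; ring
    rw [this, hr]
    field_simp
  -- The constants in front of the mixed-parity products on the left, in terms of `s`, `q`, `r`.
  have hu : 1 / (ε₂ * a) * (s * (q / s - r) / b) =
      (lam₁ - c * ε₁) / (2 * μ₁ + 1) * ((lam₂ - lam₁ * ε₂) / (2 * μ₂ + 1)) := by
    have h1 : s * (q / s - r) = (lam₂ - ε₂ * lam₁) * (ε₂ * lam₁ - C) / 4 := by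
      rw [mul_sub, mul_div_cancel₀ _ hs0, hsC, hr, hq]
      field_simp
      linear_combination lam₁ ^ 2 * h22
    have h2 : 1 / (ε₂ * a) = ε₂ / a := by field_simp; linear_combination -h22
    rw [h1, h2, show 2 * μ₁ + 1 = 2 * a by rw [ha]; ring, show 2 * μ₂ + 1 = 2 * b by rw [hb]; ring,
      hC]
    field_simp
    linear_combination 4 * (lam₁ - c * ε₁) * (lam₂ - lam₁ * ε₂) * h22
  have hv : (lam₂ - C) / 2 * (r / b) = (lam₂ - lam₁ * ε₂) / (2 * μ₂ + 1) := by
    rw [show 2 * μ₂ + 1 = 2 * b by rw [hb]; ring, hr]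
    field_simp
  have hw' : (lam₂ - C) / 2 * (1 / (ε₂ * a)) * (1 - r) = (lam₁ - c * ε₁) / (2 * μ₁ + 1) := by
    have h2 : 1 / (ε₂ * a) = ε₂ / a := by field_simp; linear_combination -h22
    rw [show 2 * μ₁ + 1 = 2 * a by rw [ha]; ring, hr, h2]
    field_simp
    rw [hC]
    linear_combination (lam₁ - c * ε₁) * h22
  -- The arguments of the functions `₀F₁`.
  have hz : (z₁ ^ 2 + z₂ ^ 2) * ((lam₂ : ℂ) ^ 2 - (c : ℂ) ^ 2) / 4 = (z₁ ^ 2 + z₂ ^ 2) * s := by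
    rw [hs]; push_cast; ring
  have hz1 : z₁ ^ 2 * ((lam₁ : ℂ) ^ 2 - (c : ℂ) ^ 2) / 4 = z₁ ^ 2 * (s - q) := by
    rw [hs, hq]; push_cast; ring
  have hz2 : z₂ ^ 2 * ((lam₂ : ℂ) ^ 2 - (lam₁ : ℂ) ^ 2) / 4 = z₂ ^ 2 * q := by
    rw [hq]; push_cast; ring
  rw [← ha, ← hb, ← hC, hz1, hz2,
    show μ₁ + 3 / 2 = a + 1 by rw [ha]; ring,
    show μ₂ + 3 / 2 = b + 1 by rw [hb]; ring]
  have hval : ∀ A₁ A₂ B₁ B₂ : ℂ,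
      (A₁ + z₁ * ((lam₁ - c * ε₁ : ℝ) : ℂ) / ((2 * μ₁ + 1 : ℝ) : ℂ) * A₂) *
        (B₁ + z₂ * ((lam₂ - lam₁ * ε₂ : ℝ) : ℂ) / ((2 * μ₂ + 1 : ℝ) : ℂ) * B₂) =
      A₁ * B₁ + z₁ * z₂ / ((ε₂ * a : ℝ) : ℂ) * (s * (q / s - r) / b : ℝ) * (A₂ * B₂) +
        (((lam₂ - C) / 2 : ℝ) : ℂ) * z₂ * (r / b : ℝ) * (A₁ * B₂) +
        (((lam₂ - C) / 2 : ℝ) : ℂ) * z₁ / ((ε₂ * a : ℝ) : ℂ) * (1 - r : ℝ) * (A₂ * B₁) := by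
    intro A₁ A₂ B₁ B₂
    have hu' := congrArg (fun t : ℝ => (t : ℂ)) hu
    have hv' := congrArg (fun t : ℝ => (t : ℂ)) hv
    have hw'' := congrArg (fun t : ℝ => (t : ℂ)) hw'
    push_cast at hu' hv' hw'' ⊢
    linear_combination (-(z₁ * z₂ * A₂ * B₂)) * hu' - (z₂ * A₁ * B₂) * hv' - (z₁ * A₂ * B₁) * hw''
  rw [hval]
  have hone : ∀ m : ℕ, (-1 : ℝ) ^ (2 * m) = 1 := fun m => by simp [pow_mul]
  refine DunklOP.hasSum_of_even_odd ha0 hb0 (by rw [ha, hb]; linarith)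
    hs0 q r (z₁ ^ 2) (z₂ ^ 2) (z₁ * z₂ / ((ε₂ * a : ℝ) : ℂ)) ((((lam₂ - C) / 2 : ℝ) : ℂ) * z₂)
    ((((lam₂ - C) / 2 : ℝ) : ℂ) * z₁ / ((ε₂ * a : ℝ) : ℂ)) _ (fun m => ?_) (fun m => ?_)
  · have hK := DunklOP.normK_mul_prefactor_even hμ₁ hμ₂ hε₁ hε₂ hlam₂ m
    rw [← ha, ← hb, ← hs] at hK
    have hK' := congrArg (fun t : ℝ => (t : ℂ)) hK
    simp only [Complex.ofReal_mul (DunklOP.normK _ _ _ _ _ _ _)] at hK'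
    rw [DunklOP.fe_even z₁ hμ₁ hμ₂ hε₂0 hz₂, DunklOP.fo_even z₁ hμ₁ hμ₂ hε₂0 hz₂,
      hz, DunklOP.bigJacobi_even, ← ha, ← hb, hX, hr', DunklOP.evenCoeff,
      show DunklOP.mu12 μ₁ μ₂ (2 * m) + 1 / 2 = a + b + 2 * m by
        rw [DunklOP.mu12, ha, hb]; push_cast; ring,
      show DunklOP.mu12 μ₁ μ₂ (2 * m) + 3 / 2 = a + (b + 1) + 2 * m by
        rw [DunklOP.mu12, ha, hb]; push_cast; ring,
      show a + 1 + b + 2 * (m : ℝ) = a + (b + 1) + 2 * m by ring,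
      show 2 * DunklOP.mu12 μ₁ μ₂ (2 * m) + 1 = 2 * (2 * m + (a + b)) by
        rw [DunklOP.mu12, ha, hb]; push_cast; ring,
      show c * DunklOP.eps12 ε₁ ε₂ (2 * m) = C by rw [DunklOP.eps12, hone, hC]; ring,
      Complex.ofReal_mul _ (DunklOP.evenJacobi _ _ _ _ _)]
    have h := DunklOP.even_term_regroup hK' hw0 (DunklOP.evenJacobi a b (q / s) r m)
      ((ε₂ * a : ℝ) : ℂ) ((2 * m + (a + b) : ℝ) : ℂ) z₁ z₂ m ((m + a : ℝ) : ℂ)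
      ((lam₂ - C : ℝ) : ℂ)
    rw [Complex.ofReal_mul 2 (2 * m + (a + b)), Complex.ofReal_div _ 2, Complex.ofReal_div 1,
      Complex.ofReal_div (m + a), Complex.ofReal_one, Complex.ofReal_ofNat]
    exact h ..
  · have hK := DunklOP.normK_mul_prefactor_odd hμ₁ hμ₂ hε₁ hε₂ hlam₂ m
    rw [← ha, ← hb, ← hs, ← hC] at hK
    have hK' := congrArg (fun t : ℝ => (t : ℂ)) hK
    simp only [Complex.ofReal_mul (DunklOP.normK _ _ _ _ _ _ _), Complex.ofReal_mul (-_),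
      Complex.ofReal_neg] at hK'
    rw [DunklOP.fe_odd z₁ hμ₁ hμ₂ hε₂0 hz₂, DunklOP.fo_odd z₁ hμ₁ hμ₂ hε₂0 hz₂,
      hz, DunklOP.bigJacobi_odd, ← ha, ← hb, hX, hr', DunklOP.oddCoeff,
      show DunklOP.mu12 μ₁ μ₂ (2 * m + 1) + 1 / 2 = a + (b + 1) + 2 * m by
        rw [DunklOP.mu12, ha, hb]; push_cast; ring,
      show DunklOP.mu12 μ₁ μ₂ (2 * m + 1) + 3 / 2 = a + 1 + (b + 1) + 2 * m by
        rw [DunklOP.mu12, ha, hb]; push_cast; ring,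
      show a + 1 + b + 2 * (m : ℝ) = a + (b + 1) + 2 * m by ring,
      show a + b + 2 * ((m + 1 : ℕ) : ℝ) = a + 1 + (b + 1) + 2 * m by push_cast; ring,
      show 2 * DunklOP.mu12 μ₁ μ₂ (2 * m + 1) + 1 = 2 * (2 * m + 1 + (a + b)) by
        rw [DunklOP.mu12, ha, hb]; push_cast; ring,
      show lam₂ - c * DunklOP.eps12 ε₁ ε₂ (2 * m + 1) = lam₂ + C by
        rw [DunklOP.eps12, pow_succ, hone, hC]; ring]
    -- The factors `λ₂ - C` of the constants and `λ₂ + C` of the odd coefficient multiply to `4 s`.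
    have hsC' : (s : ℂ) = (((lam₂ - C) / 2 : ℝ) : ℂ) * ((lam₂ + C : ℝ) : ℂ) / 2 := by
      rw [hsC]; push_cast; ring
    have h := DunklOP.odd_term_regroup hK' hw0 hsC' (DunklOP.oddJacobi a b (q / s) r m)
      ((ε₂ * a : ℝ) : ℂ) ((2 * m + 1 + (a + b) : ℝ) : ℂ) z₁ z₂ ((m + b : ℝ) : ℂ)
      ((m + (a + b) : ℝ) : ℂ)
    rw [Complex.ofReal_mul 2 (2 * m + 1 + (a + b)), Complex.ofReal_div s,
      Complex.ofReal_div (s * (m + (a + b))), Complex.ofReal_mul s, Complex.ofReal_ofNat,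
      Complex.ofReal_mul _ (DunklOP.oddJacobi _ _ _ _ _)]
    exact h ..
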